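/- **Setting.** Let $m\ge 1$. Let $f:\mathbb R\to\mathbb R$ be locally Lipschitz and even, and let $F(s)=\int_0^s f(\sigma)\,d\sigma$. Assume that there is $s_0>0$ such that $F(s_0)=0$, $F<0$ on $(0,s_0)$, and $F$ is positive, nondecreasing and unbounded on $(s_0,\infty)$. For $i,j\in\{1,\dots,m\}$ with $i\ne j$ let $\gamma_{ij}:\mathbb R\to\mathbb R$ be locally Lipschitz with $\gamma_{ij}(0)=0$ and $s\gamma_{ij}(s)\ge 0$ for all $s$, and such that either $\gamma_{ij}\equiv 0$ or there is a continuous, strictly increasing $\alpha:[0,\infty)\to[0,\infty)$ with $\alpha(0)=0$ and $|\gamma_{ij}(s)|\ge\alpha(|s|)$ for all $s$. Assume that the directed graph on $\{1,\dots,m\}$ with an edge $(i,j)$ whenever $i\neq j$ and $\gamma_{ij}\not\equiv 0$ has a node to which there is a directed path from every other node. For $\omega>0$ consider on $\mathbb R^{2m}=(\mathbb R^2)^m$, $x=(x_1,\dots,x_m)$, the rotated Liénard array $$\dot x_i=-f\big([\cos\omega t\ \ \sin\omega t]\,x_i\big)\begin{bmatrix}-\sin\omega t\\ \cos\omega t\end{bmatrix}[-\sin\omega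 t\ \ \cos\omega t]\,x_i+\sum_{j\ne i}\begin{bmatrix}-\sin\omega t\\ \cos\omega t\end{bmatrix}\gamma_{ij}\big([-\sin\omega t\ \ \cos\omega t](x_j-x_i)\big),\qquad i=1,\dots,m. \tag{1}$$ Let $$\kappa(s)=\frac2\pi\int_0^s f(\sigma)\sqrt{1-\frac{\sigma^2}{s^2}}\,d\sigma\quad(s>0).$$ For $\rho>0$ put $\mathcal R=\{x\in\mathbb R^{2m}: x_i=x_j,\ |x_i|=\rho\text{ for all }i,j\}$, and let $|x|_{\mathcal R}$ denote the Euclidean distance from $x$ to $\mathcal R$. **Theorem.** There is exactly one $\rho>0$ with $\kappa(\rho)=0$. With this $\rho$ in the definition of $\mathcal R$, the following holds. For every compact convex set $D\subset\mathbb R^2$ with $0\notin D$ and every $\delta>0$ there is $\omega^*>0$ such that for every $\omega\ge\omega^*$: (a) there is $\varepsilon>0$ such that for every initial value with $|x(0)|_{\mathcal R}\le\varepsilon$ system (1) has a solution on $[0,\infty)$, and every such solution satisfies $|x(t)|_{\mathcal R}\le\delta$ for all $t\ge 0$; (b) there is $r>0$ such that for every initial value $x(0)\in D^m$ system (1) has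 a solution on $[0,\infty)$, and every such solution satisfies $|x(t)|_{\mathcal R}\le r$ for all $t\ge 0$; (c) there is $T>0$ such that for every initial value $x(0)\in D^m$ system (1) has a solution on $[0,\infty)$, and every such solution satisfies $|x(t)|_{\mathcal R}\le\delta$ for all $t\ge T$. -/

import Mathlib

open scoped NNReal

noncomputable section

/-- The Euclidean plane. -/
abbrev Plane : Type := EuclideanSpace ℝ (Fin 2)

/-- States of an array of `m` planar oscillators: `ℝ^{2m}` with the Euclidean norm. -/
abbrev ArrayState (m : ℕ) : Type := EuclideanSpace ℝ (Fin m × Fin 2)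

/-- The state `x_i ∈ ℝ²` of the `i`-th oscillator. -/
def osc {m : ℕ} (x : ArrayState m) (i : Fin m) : Plane := !₂[x (i, 0), x (i, 1)]

/-- Class-`K` functions on the nonnegative reals. -/
structure ClassK (α : ℝ≥0 → ℝ≥0) : Prop where
  continuous : Continuous α
  map_zero : α 0 = 0
  strictMono : StrictMono α

/-- Interconnections. Only the functions `γ i j` with `i ≠ j` matter. -/
structure IsInterconnection {m : ℕ} (γ : Fin m → Fin m → ℝ → ℝ) : Prop where
  map_zero : ∀ i j, i ≠ j → γ i j 0 = 0
  sector : ∀ i j, i ≠ j → ∀ s, 0 ≤ s * γ i j s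
  zero_or_lower_bound : ∀ i j, i ≠ j →
    γ i j = 0 ∨ ∃ α : ℝ≥0 → ℝ≥0, ClassK α ∧ ∀ s, (α (Real.nnabs s) : ℝ) ≤ |γ i j s|

/-- The edges `(i, j)` of the directed graph of an interconnection. -/
def InterconnectionEdge {m : ℕ} (γ : Fin m → Fin m → ℝ → ℝ) (i j : Fin m) : Prop :=
  i ≠ j ∧ γ i j ≠ 0

/-- The graph of the interconnection has a node to which there is a directed path from every
other node. -/
def ConnectedInterconnection {m : ℕ} (γ : Fin m → Fin m → ℝ → ℝ) : Prop :=
  ∃ k : Fin m, ∀ i : Fin m, Relation.ReflTransGen (InterconnectionEdge γ) i k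

/-- The primitive `F(s) = ∫₀ˢ f`. -/
def lienardPrimitive (f : ℝ → ℝ) (s : ℝ) : ℝ := ∫ σ in (0 : ℝ)..s, f σ

/-- Liénard's conditions on the damping function `f`. -/
structure LienardCondition (f : ℝ → ℝ) : Prop where
  even : Function.Even f
  primitive : ∃ s₀ : ℝ, 0 < s₀ ∧ lienardPrimitive f s₀ = 0 ∧
    (∀ s ∈ Set.Ioo 0 s₀, lienardPrimitive f s < 0) ∧
    (∀ s ∈ Set.Ioi s₀, 0 < lienardPrimitive f s) ∧
    MonotoneOn (lienardPrimitive f) (Set.Ioi s₀) ∧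
    ¬ BddAbove (lienardPrimitive f '' Set.Ioi s₀)

/-- `κ(s) = (2/π) ∫₀ˢ f(σ) √(1 - σ²/s²) dσ`, the radial component of the averaged damping. -/
def kappa (f : ℝ → ℝ) (s : ℝ) : ℝ :=
  2 / Real.pi * ∫ σ in (0 : ℝ)..s, f σ * Real.sqrt (1 - σ ^ 2 / s ^ 2)

/-- The product `[cos φ  sin φ] v`. -/
def rotatedPosition (φ : ℝ) (v : Plane) : ℝ := Real.cos φ * v 0 + Real.sin φ * v 1

/-- The product `[-sin φ  cos φ] v`. -/
def rotatedVelocity (φ : ℝ) (v : Plane) : ℝ := -Real.sin φ * v 0 + Real.cos φ * v 1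

/-- The column vector `[-sin φ  cos φ]ᵀ`. -/
def rotatedDirection (φ : ℝ) : Plane := !₂[-Real.sin φ, Real.cos φ]

/-- The right-hand side of the Liénard array in rotating coordinates, at phase `φ`. -/
def rotatedField {m : ℕ} (f : ℝ → ℝ) (γ : Fin m → Fin m → ℝ → ℝ) (x : ArrayState m) (φ : ℝ) :
    ArrayState m :=
  WithLp.toLp 2 fun p =>
    (-((f (rotatedPosition φ (osc x p.1)) * rotatedVelocity φ (osc x p.1)) •
        rotatedDirection φ) +
      ∑ j ∈ Finset.univ.erase p.1,
        γ p.1 j (rotatedVelocity φ (osc x j - osc x p.1)) • rotatedDirection φ) p.2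

/-- `x` solves the rotated array `ẋ = ℓ(x, ω t)` on `[0, ∞)`. -/
def IsRotatedSolution {m : ℕ} (f : ℝ → ℝ) (γ : Fin m → Fin m → ℝ → ℝ) (ω : ℝ)
    (x : ℝ → ArrayState m) : Prop :=
  ∀ t, 0 ≤ t → HasDerivWithinAt x (rotatedField f γ (x t) (ω * t)) (Set.Ici 0) t

/-- The synchronization set: all components agree and lie on the circle of radius `ρ`. -/
def syncSet (m : ℕ) (ρ : ℝ) : Set (ArrayState m) :=
  {x | ∀ i j, osc x i = osc x j ∧ ‖osc x i‖ = ρ}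

end

/-! The field of the rotated array is `2π`-periodic in the phase `ω t`, so for large `ω` its
solutions follow, on any bounded time interval, those of the field averaged over the phase. The
average is radially simple: damping becomes `-k(‖z_i‖) z_i` with `k = dampAvg f`, and coupling
becomes `c_ij(‖z_j - z_i‖) (z_j - z_i)` with nonnegative coefficients, positive on the edges of the
graph (`integral_damping`, `integral_coupling`, `osc_avgField`). Since `κ(s) = s k(s)`, the zero of
`κ` is the amplitude at which the averaged damping changes sign. Liénard's condition makes `κ`
negative up to `s₀`, positive somewhere beyond it, and `s κ(s)` strictly increasing beyond `s₀`;
hence the zero `ρ` is unique.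

For the averaged array, balls of radius above `ρ` and half-planes through the origin are invariant,
because at the extremal component the coupling only pulls inwards. Intersecting half-planes gives
invariant cones, and inside a cone the negative damping at small amplitudes keeps components away
from the origin. This yields stability of the synchronization set (`IsArraySolution.stable`). For
attraction, a convex compact `D` avoiding `0` lies in an open half-plane. The largest slope over the
components does not increase, so it is constant along limit solutions; some component then attains
it forever, and so does everything reachable from that component, in particular the root. The same
holds for the smallest slope, so the root forces all slopes to agree
(`IsArraySolution.exists_near_sync`). On the common ray a one-dimensional comparison drives all
amplitudes to `ρ`.

Stability and attraction, made uniform on compact sets, survive the passage to large finite `ω`: the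
averaged comparison is restarted after each interval of a fixed length `T`
(`IsPeriodicField.practical_stability`). The comparison needs a bounded, globally Lipschitz field,
so it is carried out for a truncated field. A priori bounds show that the truncation is never
active, and uniqueness returns the result to the original array. -/

/-! ### Phase averages of damping and coupling -/

section Averages

open Set Filter MeasureTheory intervalIntegral Real Topology

/-- The averaged damping coefficient `(1/2π) ∫₀^{2π} f(r cos ψ) sin² ψ dψ`. -/
noncomputable def dampAvg (f : ℝ → ℝ) (r : ℝ) : ℝ :=
  (2 * π)⁻¹ * ∫ ψ in (0 : ℝ)..(2 * π), f (r * cos ψ) * sin ψ ^ 2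

/-- The averaged coupling coefficient `(1/2πr) ∫₀^{2π} h(r sin ψ) sin ψ dψ`. -/
noncomputable def coupAvg (h : ℝ → ℝ) (r : ℝ) : ℝ :=
  (2 * π)⁻¹ * (∫ ψ in (0 : ℝ)..(2 * π), h (r * sin ψ) * sin ψ) / r

theorem continuous_dampAvg {f : ℝ → ℝ} (hf : Continuous f) : Continuous (dampAvg f) := by
  unfold dampAvg
  refine continuous_const.mul ?_
  apply intervalIntegral.continuous_parametric_intervalIntegral_of_continuous'
  simp only [Function.uncurry_def]
  fun_prop

theorem Plane.exists_polar (v : Plane) :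
    ∃ θ : ℝ, v 0 = ‖v‖ * cos θ ∧ v 1 = ‖v‖ * sin θ := by
  have hn : ‖(⟨v 0, v 1⟩ : ℂ)‖ = ‖v‖ := by
    rw [EuclideanSpace.norm_eq, Complex.norm_def, Complex.normSq_mk]
    simp [Fin.sum_univ_two, sq]
  refine ⟨Complex.arg ⟨v 0, v 1⟩, ?_, ?_⟩
  · rw [← hn, Complex.norm_mul_cos_arg]
  · rw [← hn, Complex.norm_mul_sin_arg]

theorem integral_reflect_of_periodic {G : ℝ → ℝ} (hG : Function.Periodic G (2 * π)) (θ : ℝ) :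
    ∫ φ in (0 : ℝ)..(2 * π), G (θ - φ) = ∫ φ in (0 : ℝ)..(2 * π), G φ := by
  rw [intervalIntegral.integral_comp_sub_left (fun x => G x) θ]
  have := hG.intervalIntegral_add_eq (θ - 2 * π) 0
  simpa using this

theorem integral_eq_zero_of_reflect {G : ℝ → ℝ} (hG : Function.Periodic G (2 * π)) (θ : ℝ)
    (h : ∀ φ, G (θ - φ) = - G φ) : ∫ φ in (0 : ℝ)..(2 * π), G φ = 0 := by
  have h1 := integral_reflect_of_periodic hG θ
  simp only [h, intervalIntegral.integral_neg] at h1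
  linarith

/-- In polar coordinates the integrand depends only on `ψ = θ - φ`. Its tangential part `f(r cos ψ)
sin ψ cos ψ` is odd in `ψ` and integrates to zero, so only a radial force survives. -/
theorem integral_damping (f : ℝ → ℝ) (hf : Continuous f) (v : Plane) (q : Fin 2) :
    ∫ φ in (0 : ℝ)..(2 * π), f (rotatedPosition φ v) * rotatedVelocity φ v * rotatedDirection φ q
      = 2 * π * dampAvg f ‖v‖ * v q := by
  obtain ⟨θ, h0, h1⟩ := Plane.exists_polar v
  set r := ‖v‖
  have hπ : (2 * π) ≠ 0 := by positivity
  have hd : 2 * π * dampAvg f r = ∫ ψ in (0 : ℝ)..(2 * π), f (r * cos ψ) * sin ψ ^ 2 := by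
    unfold dampAvg; field_simp
  have hpos : ∀ φ, rotatedPosition φ v = r * cos (θ - φ) := by
    intro φ; rw [rotatedPosition, h0, h1, cos_sub]; ring
  have hvel : ∀ φ, rotatedVelocity φ v = r * sin (θ - φ) := by
    intro φ; rw [rotatedVelocity, h0, h1, sin_sub]; ring
  have hz : ∫ ψ in (0 : ℝ)..(2 * π), f (r * cos ψ) * (sin ψ * cos ψ) = 0 := by
    apply integral_eq_zero_of_reflect _ 0
    · intro φ; simp
    · intro φ; simp
  have key : ∀ a b : ℝ, ∫ φ in (0 : ℝ)..(2 * π), f (r * cos (θ - φ)) * (r * sin (θ - φ)) *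
      (a * sin (θ - φ) + b * cos (θ - φ)) = 2 * π * dampAvg f r * (r * a) := by
    intro a b
    rw [integral_reflect_of_periodic
      (G := fun ψ => f (r * cos ψ) * (r * sin ψ) * (a * sin ψ + b * cos ψ)) (by intro φ; simp)]
    have : ∀ ψ, f (r * cos ψ) * (r * sin ψ) * (a * sin ψ + b * cos ψ) =
        (r * a) * (f (r * cos ψ) * sin ψ ^ 2) + (r * b) * (f (r * cos ψ) * (sin ψ * cos ψ)) := by
      intro ψ; ring
    simp only [this]
    rw [intervalIntegral.integral_add, intervalIntegral.integral_const_mul,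
      intervalIntegral.integral_const_mul, hz, hd]
    · ring
    · exact Continuous.intervalIntegrable (by fun_prop) _ _
    · exact Continuous.intervalIntegrable (by fun_prop) _ _
  fin_cases q
  · simp only [hpos, hvel, Fin.zero_eta, h0]
    rw [← key (cos θ) (-sin θ)]
    congr 1; ext φ
    have : rotatedDirection φ 0 = cos θ * sin (θ - φ) + -sin θ * cos (θ - φ) := by
      simp only [rotatedDirection, sin_sub, cos_sub]
      simp
      linear_combination (-sin φ) * (sin_sq_add_cos_sq θ).symm
    rw [this]
  · simp only [hpos, hvel, Fin.mk_one, h1]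
    rw [← key (sin θ) (cos θ)]
    congr 1; ext φ
    have : rotatedDirection φ 1 = sin θ * sin (θ - φ) + cos θ * cos (θ - φ) := by
      simp only [rotatedDirection, sin_sub, cos_sub]
      simp
      linear_combination (cos φ) * (sin_sq_add_cos_sq θ).symm
    rw [this]

/-- As for the damping, but the tangential part `h(r sin ψ) cos ψ` cancels under `ψ ↦ π - ψ`, so no
oddness of `h` is needed. -/
theorem integral_coupling (h : ℝ → ℝ) (hh : Continuous h) (v : Plane) (q : Fin 2) :
    ∫ φ in (0 : ℝ)..(2 * π), h (rotatedVelocity φ v) * rotatedDirection φ q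
      = 2 * π * coupAvg h ‖v‖ * v q := by
  obtain ⟨θ, h0, h1⟩ := Plane.exists_polar v
  set r := ‖v‖ with hr
  have hπ : (2 * π) ≠ 0 := by positivity
  have hvel : ∀ φ, rotatedVelocity φ v = r * sin (θ - φ) := by
    intro φ; rw [rotatedVelocity, h0, h1, sin_sub]; ring
  have hz : ∫ ψ in (0 : ℝ)..(2 * π), h (r * sin ψ) * cos ψ = 0 := by
    apply integral_eq_zero_of_reflect _ π
    · intro φ; simp
    · intro φ; simp
  have hd : 2 * π * coupAvg h r * r = ∫ ψ in (0 : ℝ)..(2 * π), h (r * sin ψ) * sin ψ := by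
    -- At `r = 0` the division in `coupAvg` returns a default value, but both sides vanish: the
    -- integrand is a constant multiple of `sin`.
    rcases eq_or_ne r 0 with h' | h'
    · rw [h', mul_zero]
      simp only [zero_mul, intervalIntegral.integral_const_mul, integral_sin, cos_two_pi, cos_zero]
      simp
    · unfold coupAvg; field_simp
  have key : ∀ a b : ℝ, ∫ φ in (0 : ℝ)..(2 * π), h (r * sin (θ - φ)) *
      (a * sin (θ - φ) + b * cos (θ - φ)) = 2 * π * coupAvg h r * (r * a) := by
    intro a b
    rw [integral_reflect_of_periodic
      (G := fun ψ => h (r * sin ψ) * (a * sin ψ + b * cos ψ)) (by intro φ; simp)]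
    have : ∀ ψ, h (r * sin ψ) * (a * sin ψ + b * cos ψ) =
        a * (h (r * sin ψ) * sin ψ) + b * (h (r * sin ψ) * cos ψ) := by
      intro ψ; ring
    simp only [this]
    rw [intervalIntegral.integral_add, intervalIntegral.integral_const_mul,
      intervalIntegral.integral_const_mul, hz, ← hd]
    · ring
    · exact Continuous.intervalIntegrable (by fun_prop) _ _
    · exact Continuous.intervalIntegrable (by fun_prop) _ _
  fin_cases q
  · simp only [hvel, Fin.zero_eta, h0]
    rw [← key (cos θ) (-sin θ)]
    congr 1; ext φ
    have : rotatedDirection φ 0 = cos θ * sin (θ - φ) + -sin θ * cos (θ - φ) := by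
      simp only [rotatedDirection, sin_sub, cos_sub]
      simp
      linear_combination (-sin φ) * (sin_sq_add_cos_sq θ).symm
    rw [this]
  · simp only [hvel, Fin.mk_one, h1]
    rw [← key (sin θ) (cos θ)]
    congr 1; ext φ
    have : rotatedDirection φ 1 = sin θ * sin (θ - φ) + cos θ * cos (θ - φ) := by
      simp only [rotatedDirection, sin_sub, cos_sub]
      simp
      linear_combination (cos φ) * (sin_sq_add_cos_sq θ).symm
    rw [this]

theorem coupAvg_nonneg {h : ℝ → ℝ} (hs : ∀ s, 0 ≤ s * h s) {r : ℝ} (hr : 0 ≤ r) :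
    0 ≤ coupAvg h r := by
  rcases hr.eq_or_lt with rfl | hr
  · simp [coupAvg]
  unfold coupAvg
  have : 0 ≤ ∫ ψ in (0 : ℝ)..(2 * π), h (r * sin ψ) * sin ψ := by
    apply intervalIntegral.integral_nonneg (by positivity)
    intro ψ _
    have h1 := hs (r * sin ψ)
    have h2 : r * sin ψ * h (r * sin ψ) = r * (h (r * sin ψ) * sin ψ) := by ring
    rw [h2] at h1
    exact nonneg_of_mul_nonneg_right h1 hr
  positivity

theorem coupAvg_pos {h : ℝ → ℝ} (hh : Continuous h) (hs : ∀ s, 0 ≤ s * h s)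
    (hne : ∀ s, s ≠ 0 → h s ≠ 0) {r : ℝ} (hr : 0 < r) : 0 < coupAvg h r := by
  unfold coupAvg
  have key : ∀ ψ, 0 ≤ h (r * sin ψ) * sin ψ := by
    intro ψ
    have h1 := hs (r * sin ψ)
    have h2 : r * sin ψ * h (r * sin ψ) = r * (h (r * sin ψ) * sin ψ) := by ring
    rw [h2] at h1
    exact nonneg_of_mul_nonneg_right h1 hr
  have : 0 < ∫ ψ in (0 : ℝ)..(2 * π), h (r * sin ψ) * sin ψ := by
    apply intervalIntegral.integral_pos (by positivity) (by fun_prop) (fun ψ _ => key ψ)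
    refine ⟨π / 2, ⟨by positivity, by linarith [pi_pos]⟩, ?_⟩
    refine (key _).lt_of_ne' ?_
    simp only [sin_pi_div_two, mul_one]
    exact hne r hr.ne'
  positivity

/-- The linear bound on `h` compensates the division by `r`, so the coefficient stays bounded near
`r = 0`. -/
theorem abs_coupAvg_le {h : ℝ → ℝ} {L r R : ℝ} (hL0 : 0 ≤ L)
    (hL : ∀ s, |s| ≤ R → |h s| ≤ L * |s|) (hr : 0 ≤ r) (hrR : r ≤ R) :
    |coupAvg h r| ≤ L := by
  rcases hr.eq_or_lt with rfl | hr
  · simpa [coupAvg] using hL0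
  have : ‖∫ ψ in (0 : ℝ)..(2 * π), h (r * sin ψ) * sin ψ‖ ≤ L * r * |2 * π - 0| := by
    apply intervalIntegral.norm_integral_le_of_norm_le_const
    intro ψ _
    rw [norm_mul, norm_eq_abs, norm_eq_abs]
    have h1 : |r * sin ψ| ≤ r := by
      rw [abs_mul, abs_of_pos hr]
      exact mul_le_of_le_one_right hr.le (abs_sin_le_one ψ)
    have h2 := hL _ (h1.trans hrR)
    calc |h (r * sin ψ)| * |sin ψ| ≤ |h (r * sin ψ)| * 1 := by
          gcongr; exact abs_sin_le_one ψ
      _ ≤ L * r := by rw [mul_one]; exact h2.trans (by gcongr)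
  rw [norm_eq_abs, sub_zero, abs_of_pos (by positivity : 0 < 2 * π)] at this
  unfold coupAvg
  rw [abs_div, abs_mul, abs_of_pos hr, abs_of_pos (by positivity : 0 < (2 * π)⁻¹),
    div_le_iff₀ hr, inv_mul_le_iff₀ (by positivity)]
  linarith

/-! ### The unique zero of `κ` under Liénard's condition -/

theorem integral_circle_eq_four_mul {G : ℝ → ℝ} (hG : Continuous G)
    (hper : Function.Periodic G π) (heven : ∀ ψ, G (-ψ) = G ψ) :
    ∫ ψ in (0 : ℝ)..(2 * π), G ψ = 4 * ∫ ψ in (0 : ℝ)..(π / 2), G ψ := by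
  have hi : ∀ a b, IntervalIntegrable G volume a b := fun a b => hG.intervalIntegrable a b
  have h1 : ∫ ψ in (0 : ℝ)..(2 * π), G ψ = 2 * ∫ ψ in (0 : ℝ)..π, G ψ := by
    rw [← integral_add_adjacent_intervals (hi 0 π) (hi π (2 * π))]
    have := hper.intervalIntegral_add_eq π 0
    rw [zero_add, ← two_mul] at this
    rw [this]; ring
  have h2 : ∫ ψ in (0 : ℝ)..π, G ψ = ∫ ψ in (-(π / 2))..(π / 2), G ψ := by
    have := hper.intervalIntegral_add_eq (-(π / 2)) 0
    rw [zero_add, show -(π / 2) + π = π / 2 by ring] at this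
    exact this.symm
  have h3 : ∫ ψ in (-(π / 2))..0, G ψ = ∫ ψ in (0 : ℝ)..(π / 2), G ψ := by
    have := intervalIntegral.integral_comp_neg (a := 0) (b := π / 2) G
    simp only [heven, neg_zero] at this
    exact this.symm
  rw [h1, h2, ← integral_add_adjacent_intervals (hi _ 0) (hi 0 _), h3]
  ring

theorem kappa_eq_mul_integral_sin {f : ℝ → ℝ} (hf : Continuous f) {s : ℝ} (hs : 0 < s) :
    kappa f s = 2 / π * (s * ∫ ψ in (0 : ℝ)..(π / 2), f (s * cos ψ) * sin ψ ^ 2) := by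
  unfold kappa
  congr 1
  have := intervalIntegral.integral_comp_mul_deriv (a := 0) (b := π / 2)
    (f := fun ψ => s * cos ψ) (f' := fun ψ => s * (-sin ψ))
    (g := fun σ => f σ * √(1 - σ ^ 2 / s ^ 2))
    (fun x _ => (hasDerivAt_cos x).const_mul s) (by fun_prop) (by fun_prop)
  simp only [cos_pi_div_two, cos_zero, mul_zero, mul_one, Function.comp_apply] at this
  rw [intervalIntegral.integral_symm, ← this, ← intervalIntegral.integral_neg,
    ← intervalIntegral.integral_const_mul]
  apply intervalIntegral.integral_congr
  intro ψ hψ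
  rw [uIcc_of_le (by positivity)] at hψ
  have h1 : 0 ≤ sin ψ := sin_nonneg_of_nonneg_of_le_pi hψ.1 (by linarith [hψ.2, pi_pos])
  have h2 : √(1 - (s * cos ψ) ^ 2 / s ^ 2) = sin ψ := by
    rw [show 1 - (s * cos ψ) ^ 2 / s ^ 2 = sin ψ ^ 2 by
      rw [mul_pow, mul_div_cancel_left₀ _ (by positivity), sin_sq]]
    exact sqrt_sq h1
  simp only [h2]
  ring

/-- Substituting `σ = s cos ψ` turns `κ` into an integral over a quarter circle; evenness of `f`
makes the full circle four such quarters. -/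
theorem kappa_eq_mul_dampAvg {f : ℝ → ℝ} (hf : Continuous f) (he : Function.Even f) {s : ℝ}
    (hs : 0 < s) : kappa f s = s * dampAvg f s := by
  rw [kappa_eq_mul_integral_sin hf hs, dampAvg, integral_circle_eq_four_mul]
  · field_simp; ring
  · fun_prop
  · intro ψ; simp [he (s * cos ψ)]
  · intro ψ; simp

variable {f : ℝ → ℝ}

theorem hasDerivAt_lienardPrimitive (hf : Continuous f) (s : ℝ) :
    HasDerivAt (lienardPrimitive f) (f s) s :=
  intervalIntegral.integral_hasDerivAt_right (hf.intervalIntegrable _ _)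
    (hf.stronglyMeasurableAtFilter _ _) hf.continuousAt

theorem continuous_lienardPrimitive (hf : Continuous f) : Continuous (lienardPrimitive f) :=
  continuous_iff_continuousAt.2 fun s => (hasDerivAt_lienardPrimitive hf s).continuousAt

/-- Integration by parts replaces `f` by its primitive, the function whose sign Liénard's condition
controls. -/
theorem kappa_eq_integral_primitive (hf : Continuous f) {s : ℝ} (hs : 0 < s) :
    kappa f s = 2 / π * ∫ ψ in (0 : ℝ)..(π / 2), lienardPrimitive f (s * cos ψ) * cos ψ := by
  rw [kappa_eq_mul_integral_sin hf hs]
  congr 1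
  have hF := continuous_lienardPrimitive hf
  have := intervalIntegral.integral_mul_deriv_eq_deriv_mul (a := 0) (b := π / 2)
    (u := fun ψ => lienardPrimitive f (s * cos ψ)) (u' := fun ψ => f (s * cos ψ) * (s * (-sin ψ)))
    (v := sin) (v' := cos)
    (fun x _ => HasDerivAt.comp (h₂ := lienardPrimitive f) (h := fun ψ => s * cos ψ) x
      (hasDerivAt_lienardPrimitive hf (s * cos x)) ((hasDerivAt_cos x).const_mul s))
    (fun x _ => hasDerivAt_sin x) (Continuous.intervalIntegrable (by fun_prop) _ _)
    (Continuous.intervalIntegrable (by fun_prop) _ _)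
  simp only [cos_pi_div_two, mul_zero, sin_zero, sub_zero] at this
  rw [this, ← intervalIntegral.integral_const_mul, show lienardPrimitive f 0 = 0 by
    simp [lienardPrimitive], zero_mul, zero_sub, ← intervalIntegral.integral_neg]
  congr 1; ext ψ; ring

theorem continuousOn_kappa (hf : Continuous f) : ContinuousOn (kappa f) (Ioi 0) := by
  have hc : Continuous fun s : ℝ => 2 / π *
      (s * ∫ ψ in (0 : ℝ)..(π / 2), f (s * cos ψ) * sin ψ ^ 2) := by
    refine continuous_const.mul (continuous_id.mul ?_)
    apply intervalIntegral.continuous_parametric_intervalIntegral_of_continuous'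
    simp only [Function.uncurry_def]
    fun_prop
  exact hc.continuousOn.congr fun s hs => kappa_eq_mul_integral_sin hf hs

theorem kappa_neg_of_le (hf : Continuous f) {s₀ s : ℝ}
    (hneg : ∀ σ ∈ Ioo 0 s₀, lienardPrimitive f σ < 0)
    (hs : 0 < s) (hss : s ≤ s₀) : kappa f s < 0 := by
  rw [kappa_eq_integral_primitive hf hs]
  have hF := continuous_lienardPrimitive hf
  have key : 0 < ∫ ψ in (0 : ℝ)..(π / 2), -(lienardPrimitive f (s * cos ψ) * cos ψ) := by
    apply intervalIntegral.intervalIntegral_pos_of_pos_on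
      (Continuous.intervalIntegrable (by fun_prop) _ _) _ (by positivity)
    intro ψ hψ
    have hc : 0 < cos ψ := cos_pos_of_mem_Ioo ⟨by linarith [hψ.1, pi_pos], hψ.2⟩
    have hc1 : cos ψ < 1 := by
      rw [← cos_zero]
      exact cos_lt_cos_of_nonneg_of_le_pi_div_two le_rfl hψ.2.le hψ.1
    have := hneg (s * cos ψ) ⟨by positivity, by nlinarith⟩
    nlinarith
  rw [intervalIntegral.integral_neg] at key
  have : 0 < 2 / π := by positivity
  nlinarith

theorem exists_kappa_pos (hf : Continuous f) {s₀ : ℝ} (hs₀ : 0 < s₀)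
    (hmono : MonotoneOn (lienardPrimitive f) (Ioi s₀))
    (hub : ¬ BddAbove (lienardPrimitive f '' Ioi s₀)) : ∃ s, s₀ < s ∧ 0 < kappa f s := by
  have hF := continuous_lienardPrimitive hf
  obtain ⟨C, hC⟩ := (isCompact_Icc (a := 0) (b := s₀ + 1)).exists_bound_of_continuousOn
    hF.continuousOn
  have hC0 : 0 ≤ C := (norm_nonneg _).trans (hC 0 ⟨le_rfl, by linarith⟩)
  have hlow : ∀ σ, 0 ≤ σ → -C ≤ lienardPrimitive f σ := by
    intro σ hσ
    rcases le_total σ (s₀ + 1) with h | h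
    · exact (abs_le.1 (hC σ ⟨hσ, h⟩)).1
    · exact (abs_le.1 (hC (s₀ + 1) ⟨by linarith, le_rfl⟩)).1.trans
        (hmono (by simp) (by simp; linarith) h)
  -- With amplitude `2a`, the argument `2a cos ψ` is at least `a` on `[0, π/3]`, where the primitive
  -- exceeds `3C`; on the rest it is at least `-C`. The total exceeds `3C sin(π/3) - C(1 - sin(π/3))
  -- ≥ C`.
  have : ∃ a, s₀ < a ∧ 3 * C < lienardPrimitive f a := by
    by_contra! hcon
    exact hub ⟨3 * C, by rintro _ ⟨a, ha, rfl⟩; exact hcon a ha⟩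
  obtain ⟨a, ha, hab⟩ := this
  refine ⟨2 * a, by linarith, ?_⟩
  have ha0 : 0 < a := hs₀.trans ha
  rw [kappa_eq_integral_primitive hf (by linarith)]
  have hint : ∀ p q, IntervalIntegrable
      (fun ψ => lienardPrimitive f (2 * a * cos ψ) * cos ψ) volume p q :=
    fun p q => Continuous.intervalIntegrable (by fun_prop) _ _
  have h1 : ∫ ψ in (0 : ℝ)..(π / 3), 3 * C * cos ψ <
      ∫ ψ in (0 : ℝ)..(π / 3), lienardPrimitive f (2 * a * cos ψ) * cos ψ := by
    apply intervalIntegral.integral_lt_integral_of_continuousOn_of_le_of_exists_lt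
      (by positivity) (by fun_prop) (by fun_prop)
    · intro ψ hψ
      have hc : 1 / 2 ≤ cos ψ := by
        rw [← cos_pi_div_three]
        exact cos_le_cos_of_nonneg_of_le_pi hψ.1.le (by linarith [pi_pos]) hψ.2
      have := hmono (mem_Ioi.2 ha) (mem_Ioi.2 (by nlinarith)) (show a ≤ 2 * a * cos ψ by nlinarith)
      nlinarith
    · refine ⟨0, ⟨le_rfl, by positivity⟩, ?_⟩
      have := hmono (mem_Ioi.2 ha) (mem_Ioi.2 (by linarith)) (show a ≤ 2 * a by linarith)
      simp only [cos_zero, mul_one]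
      linarith
  have h2 : ∫ ψ in (π / 3)..(π / 2), -C * cos ψ ≤
      ∫ ψ in (π / 3)..(π / 2), lienardPrimitive f (2 * a * cos ψ) * cos ψ := by
    apply intervalIntegral.integral_mono_on (by linarith [pi_pos])
      (Continuous.intervalIntegrable (by fun_prop) _ _) (hint _ _)
    intro ψ hψ
    have hc : 0 ≤ cos ψ := cos_nonneg_of_mem_Icc ⟨by linarith [hψ.1, pi_pos], hψ.2⟩
    have := hlow (2 * a * cos ψ) (by positivity)
    nlinarith
  rw [intervalIntegral.integral_const_mul, integral_cos] at h1 h2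
  rw [← integral_add_adjacent_intervals (hint 0 (π / 3)) (hint (π / 3) (π / 2))]
  have h3 : 1 / 2 ≤ sin (π / 3) := by
    rw [sin_pi_div_three]
    have : 1 ≤ √3 := by rw [one_le_sqrt]; norm_num
    linarith
  rw [sin_zero] at h1
  rw [sin_pi_div_two] at h2
  have h4 : 0 < 2 / π := by positivity
  apply mul_pos h4
  nlinarith

theorem kappa_mul_self {s : ℝ} (hs : 0 < s) :
    s * kappa f s = 2 / π * ∫ σ in (0 : ℝ)..s, f σ * √(s ^ 2 - σ ^ 2) := by
  unfold kappa
  rw [mul_left_comm, ← intervalIntegral.integral_const_mul]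
  congr 2; ext σ
  rw [show s ^ 2 - σ ^ 2 = s ^ 2 * (1 - σ ^ 2 / s ^ 2) by field_simp,
    sqrt_mul (by positivity), sqrt_sq hs.le]
  ring

/-- The weight `√(s² - σ²)` increases with `s`. Beyond `s₀` this suffices because `f ≥ 0` there. On
`[0, s₀]` the sign of `f` is unknown, so one integrates by parts: the primitive vanishes at both
ends and is negative between them, while the difference of two weights is increasing in `σ`. -/
theorem strictMonoOn_mul_kappa (hf : Continuous f) {s₀ : ℝ} (hs₀ : 0 < s₀)
    (hz : lienardPrimitive f s₀ = 0) (hneg : ∀ σ ∈ Ioo 0 s₀, lienardPrimitive f σ < 0)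
    (hmono : MonotoneOn (lienardPrimitive f) (Ioi s₀)) :
    StrictMonoOn (fun s => s * kappa f s) (Ioi s₀) := by
  have hF := continuous_lienardPrimitive hf
  have hfpos : ∀ σ, s₀ ≤ σ → 0 ≤ f σ := by
    have h1 : ∀ σ, s₀ < σ → 0 ≤ f σ := by
      intro σ hσ
      have h2 := (hasDerivAt_lienardPrimitive hf σ).deriv
      have h3 : derivWithin (lienardPrimitive f) (Ioi s₀) σ = deriv (lienardPrimitive f) σ :=
        derivWithin_of_mem_nhds (Ioi_mem_nhds hσ)
      rw [← h2, ← h3]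
      exact hmono.derivWithin_nonneg
    intro σ hσ
    -- Continuity adds the endpoint `s₀`, where monotonicity gives nothing directly.
    have : Icc s₀ (σ + 1) ⊆ {x | 0 ≤ f x} := by
      rw [← closure_Ioc (show s₀ ≠ σ + 1 by linarith)]
      exact closure_minimal (fun x hx => h1 x hx.1) (isClosed_le continuous_const hf)
    exact this ⟨hσ, by linarith⟩
  intro s hs t ht hst
  have hs' : s₀ < s := hs
  have hs0 : 0 < s := hs₀.trans hs
  have ht0 : 0 < t := hs0.trans hst
  simp only [kappa_mul_self hs0, kappa_mul_self ht0]
  have hpi : 0 < 2 / π := by positivity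
  refine mul_lt_mul_of_pos_left ?_ hpi
  have hct : Continuous fun σ => f σ * √(t ^ 2 - σ ^ 2) := by fun_prop
  have hcs : Continuous fun σ => f σ * √(s ^ 2 - σ ^ 2) := by fun_prop
  have e1 := integral_add_adjacent_intervals (hct.intervalIntegrable (μ := volume) 0 s₀)
    (hct.intervalIntegrable s₀ s)
  have e2 := integral_add_adjacent_intervals (hct.intervalIntegrable (μ := volume) 0 s)
    (hct.intervalIntegrable s t)
  have e3 := integral_add_adjacent_intervals (hcs.intervalIntegrable (μ := volume) 0 s₀)
    (hcs.intervalIntegrable s₀ s)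
  have i1 : ∫ σ in s₀..s, f σ * √(s ^ 2 - σ ^ 2) ≤ ∫ σ in s₀..s, f σ * √(t ^ 2 - σ ^ 2) := by
    apply intervalIntegral.integral_mono_on hs'.le (hcs.intervalIntegrable _ _)
      (hct.intervalIntegrable _ _)
    intro σ hσ
    have := hfpos σ hσ.1
    gcongr
  have i2 : 0 ≤ ∫ σ in s..t, f σ * √(t ^ 2 - σ ^ 2) := by
    apply intervalIntegral.integral_nonneg hst.le
    intro σ hσ
    have := hfpos σ (hs'.le.trans hσ.1)
    positivity
  have i3 : ∫ σ in (0 : ℝ)..s₀, f σ * √(s ^ 2 - σ ^ 2) <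
      ∫ σ in (0 : ℝ)..s₀, f σ * √(t ^ 2 - σ ^ 2) := by
    rw [← sub_pos, ← intervalIntegral.integral_sub (hct.intervalIntegrable _ _)
      (hcs.intervalIntegrable _ _)]
    have hlt : ∀ σ ∈ uIcc 0 s₀, σ ^ 2 < s ^ 2 ∧ σ ^ 2 < t ^ 2 := by
      intro σ hσ
      rw [uIcc_of_le hs₀.le] at hσ
      constructor <;> nlinarith [hσ.1, hσ.2]
    have hw : ∀ r : ℝ, ∀ σ, σ ^ 2 < r ^ 2 →
        HasDerivAt (fun σ => √(r ^ 2 - σ ^ 2)) (-σ / √(r ^ 2 - σ ^ 2)) σ := by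
      intro r σ h
      have h1 : HasDerivAt (fun σ : ℝ => r ^ 2 - σ ^ 2) (-(2 * σ)) σ := by
        simpa using ((hasDerivAt_pow 2 σ).const_sub (r ^ 2))
      convert h1.sqrt (by linarith) using 1
      rw [neg_div, neg_div, mul_div_mul_left _ _ two_ne_zero]
    have hwc : ∀ r : ℝ, (∀ σ ∈ uIcc 0 s₀, σ ^ 2 < r ^ 2) →
        ContinuousOn (fun σ => -σ / √(r ^ 2 - σ ^ 2)) (uIcc 0 s₀) := by
      intro r hr
      refine ContinuousOn.div (by fun_prop) (by fun_prop) ?_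
      intro σ hσ
      exact (sqrt_pos.2 (sub_pos.2 (hr σ hσ))).ne'
    have hibp := intervalIntegral.integral_mul_deriv_eq_deriv_mul (a := 0) (b := s₀)
      (u := fun σ => √(t ^ 2 - σ ^ 2) - √(s ^ 2 - σ ^ 2))
      (u' := fun σ => -σ / √(t ^ 2 - σ ^ 2) - -σ / √(s ^ 2 - σ ^ 2))
      (v := lienardPrimitive f) (v' := f)
      (fun σ hσ => (hw t σ (hlt σ hσ).2).sub (hw s σ (hlt σ hσ).1))
      (fun σ _ => hasDerivAt_lienardPrimitive hf σ)
      (((hwc t fun σ hσ => (hlt σ hσ).2).sub (hwc s fun σ hσ => (hlt σ hσ).1)).intervalIntegrable)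
      (hf.intervalIntegrable _ _)
    have hF0 : lienardPrimitive f 0 = 0 := by simp [lienardPrimitive]
    rw [hz, hF0, mul_zero, mul_zero, sub_zero, zero_sub, ← intervalIntegral.integral_neg] at hibp
    have : ∀ σ, f σ * √(t ^ 2 - σ ^ 2) - f σ * √(s ^ 2 - σ ^ 2) =
      (√(t ^ 2 - σ ^ 2) - √(s ^ 2 - σ ^ 2)) * f σ := fun σ => by ring
    simp only [this]
    rw [hibp]
    apply intervalIntegral.intervalIntegral_pos_of_pos_on _ _ hs₀
    · apply ContinuousOn.intervalIntegrable
      exact (((hwc t fun σ hσ => (hlt σ hσ).2).sub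
        (hwc s fun σ hσ => (hlt σ hσ).1)).mul hF.continuousOn).neg
    · intro σ hσ
      have hσ' : σ ∈ uIcc 0 s₀ := by rw [uIcc_of_le hs₀.le]; exact Ioo_subset_Icc_self hσ
      obtain ⟨h1, h2⟩ := hlt σ hσ'
      have h3 : 0 < √(s ^ 2 - σ ^ 2) := sqrt_pos.2 (sub_pos.2 h1)
      have h4 : √(s ^ 2 - σ ^ 2) < √(t ^ 2 - σ ^ 2) := by
        apply sqrt_lt_sqrt (by linarith); nlinarith
      have h5 : σ / √(t ^ 2 - σ ^ 2) < σ / √(s ^ 2 - σ ^ 2) :=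
        div_lt_div_of_pos_left hσ.1 h3 h4
      have h6 := hneg σ hσ
      rw [neg_div, neg_div]
      nlinarith
  linarith

theorem exists_unique_zero_kappa (hf : Continuous f) (hL : LienardCondition f) :
    ∃ ρ, 0 < ρ ∧ kappa f ρ = 0 ∧ (∀ s, 0 < s → s < ρ → kappa f s < 0) ∧
      (∀ s, ρ < s → 0 < kappa f s) := by
  obtain ⟨s₀, hs₀, hz, hneg, -, hmono, hub⟩ := hL.primitive
  obtain ⟨s₁, hs₁, hk⟩ := exists_kappa_pos hf hs₀ hmono hub
  have hlow : ∀ s, 0 < s → s ≤ s₀ → kappa f s < 0 := fun s h1 h2 =>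
    kappa_neg_of_le hf hneg h1 h2
  obtain ⟨ρ, hρ, hρ0⟩ := intermediate_value_Icc hs₁.le
    ((continuousOn_kappa hf).mono fun x hx => hs₀.trans_le hx.1)
    (show (0 : ℝ) ∈ Icc _ _ from ⟨(hlow s₀ hs₀ le_rfl).le, hk.le⟩)
  have hρs : s₀ < ρ := by
    refine hρ.1.lt_of_ne ?_
    rintro rfl
    exact (hlow s₀ hs₀ le_rfl).ne hρ0
  have hm := strictMonoOn_mul_kappa hf hs₀ hz hneg hmono
  refine ⟨ρ, hs₀.trans hρs, hρ0, fun s h1 h2 => ?_, fun s h1 => ?_⟩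
  · rcases le_or_gt s s₀ with h | h
    · exact hlow s h1 h
    · have := hm h hρs h2
      simp only [hρ0, mul_zero] at this
      exact neg_of_mul_neg_right this h1.le
  · have := hm hρs (hρs.trans h1) h1
    simp only [hρ0, mul_zero] at this
    exact pos_of_mul_pos_right this ((hs₀.trans hρs).trans h1).le

theorem exists_sign_change_dampAvg (hf : Continuous f) (hL : LienardCondition f) :
    ∃ ρ, 0 < ρ ∧ kappa f ρ = 0 ∧ (∀ s, 0 < s → kappa f s = 0 → s = ρ) ∧
      (∀ s, 0 < s → s < ρ → dampAvg f s < 0) ∧ (∀ s, ρ < s → 0 < dampAvg f s) := by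
  obtain ⟨ρ, hρ, h0, h1, h2⟩ := exists_unique_zero_kappa hf hL
  refine ⟨ρ, hρ, h0, fun s hs hs0 => ?_, fun s hs hsρ => ?_, fun s hs => ?_⟩
  · rcases lt_trichotomy s ρ with h | h | h
    · exact absurd hs0 (h1 s hs h).ne
    · exact h
    · exact absurd hs0 (h2 s h).ne'
  · have := h1 s hs hsρ
    rw [kappa_eq_mul_dampAvg hf hL.even hs] at this
    exact neg_of_mul_neg_right this hs.le
  · have := h2 s hs
    rw [kappa_eq_mul_dampAvg hf hL.even (hρ.trans hs)] at this
    exact pos_of_mul_pos_right this (hρ.trans hs).le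

end Averages

/-! ### Global forward solutions, uniqueness and limit solutions -/

section ForwardSolutions

open Set Filter Topology MeasureTheory intervalIntegral Real

variable {E : Type*} [NormedAddCommGroup E] [NormedSpace ℝ E]

/-- `x` solves `ẋ = v(t, x)` on `[0, ∞)`. -/
def IsForwardSolution (v : ℝ → E → E) (x : ℝ → E) : Prop :=
  ∀ t, 0 ≤ t → HasDerivWithinAt x (v t (x t)) (Ici 0) t

namespace IsForwardSolution

variable {v : ℝ → E → E} {x y : ℝ → E} {L B : ℝ≥0}

theorem continuousOn (hx : IsForwardSolution v x) : ContinuousOn x (Ici 0) :=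
  fun t ht => (hx t ht).continuousWithinAt

theorem hasDerivWithinAt_Ici (hx : IsForwardSolution v x) {t : ℝ} (ht : 0 ≤ t) :
    HasDerivWithinAt x (v t (x t)) (Ici t) t :=
  (hx t ht).mono (Ici_subset_Ici.2 ht)

theorem shift (hx : IsForwardSolution v x) {s : ℝ} (hs : 0 ≤ s) :
    IsForwardSolution (fun t => v (s + t)) (fun t => x (s + t)) := by
  intro t ht
  have h1 := hx (s + t) (add_nonneg hs ht)
  have h2 : HasDerivWithinAt (fun t => s + t) 1 (Ici 0) t :=
    ((hasDerivAt_id t).const_add s).hasDerivWithinAt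
  have := h1.scomp t h2 (fun u hu => mem_Ici.2 (add_nonneg hs hu))
  rw [one_smul] at this
  exact this

theorem dist_le (hx : IsForwardSolution v x) (hy : IsForwardSolution v y)
    (hv : ∀ t, LipschitzWith L (v t)) {t : ℝ} (ht : 0 ≤ t) :
    dist (x t) (y t) ≤ dist (x 0) (y 0) * exp (L * t) := by
  have := dist_le_of_trajectories_ODE (a := 0) (b := t) hv
    (hx.continuousOn.mono Icc_subset_Ici_self) (fun u hu => hx.hasDerivWithinAt_Ici hu.1)
    (hy.continuousOn.mono Icc_subset_Ici_self) (fun u hu => hy.hasDerivWithinAt_Ici hu.1)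
    le_rfl t ⟨ht, le_rfl⟩
  simpa using this

theorem norm_sub_le (hx : IsForwardSolution v x) (hB : ∀ t y, ‖v t y‖ ≤ B) {s t : ℝ}
    (hs : 0 ≤ s) (ht : 0 ≤ t) : ‖x t - x s‖ ≤ B * |t - s| :=
  Convex.norm_image_sub_le_of_norm_hasDerivWithin_le (fun u hu => hx u hu)
    (fun _ _ => hB _ _) (convex_Ici 0) hs ht

theorem eqOn_of_lipschitzOn {v : ℝ → E → E} {x y : ℝ → E}
    (hv : ∀ R : ℝ, ∃ K : ℝ≥0, ∀ t, LipschitzOnWith K (v t) (Metric.closedBall 0 R))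
    (hx : IsForwardSolution v x) (hy : IsForwardSolution v y) (h0 : x 0 = y 0) :
    EqOn x y (Ici 0) := by
  intro t ht
  have hc : ∀ z, IsForwardSolution v z → ∃ R, ∀ u ∈ Icc 0 t, ‖z u‖ ≤ R := fun z hz =>
    isCompact_Icc.exists_bound_of_continuousOn (hz.continuousOn.mono Icc_subset_Ici_self)
  obtain ⟨R₁, h1⟩ := hc x hx
  obtain ⟨R₂, h2⟩ := hc y hy
  obtain ⟨K, hK⟩ := hv (max R₁ R₂)
  have := dist_le_of_trajectories_ODE_of_mem (a := 0) (b := t) (δ := 0)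
    (s := fun _ => Metric.closedBall 0 (max R₁ R₂)) (fun u _ => hK u)
    (hx.continuousOn.mono Icc_subset_Ici_self) (fun u hu => hx.hasDerivWithinAt_Ici hu.1)
    (fun u hu => mem_closedBall_zero_iff.2 ((h1 u (Ico_subset_Icc_self hu)).trans (le_max_left _ _)))
    (hy.continuousOn.mono Icc_subset_Ici_self) (fun u hu => hy.hasDerivWithinAt_Ici hu.1)
    (fun u hu => mem_closedBall_zero_iff.2
      ((h2 u (Ico_subset_Icc_self hu)).trans (le_max_right _ _)))
    (by simp [h0]) t ⟨ht, le_rfl⟩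
  simpa using this

end IsForwardSolution

/-- A globally bounded field cannot leave the ball of radius `B (n + 1)` within time `n + 1`, so
Picard–Lindelöf applies on each `[0, n + 1]`; uniqueness glues the pieces. -/
theorem exists_isForwardSolution [CompleteSpace E] {v : ℝ → E → E} {L B : ℝ≥0}
    (hv : ∀ t, LipschitzWith L (v t)) (hc : ∀ y, Continuous fun t => v t y)
    (hB : ∀ t y, ‖v t y‖ ≤ B) (x₀ : E) : ∃ x, x 0 = x₀ ∧ IsForwardSolution v x := by
  have hloc : ∀ n : ℕ, ∃ α : ℝ → E, α 0 = x₀ ∧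
      ∀ t ∈ Icc (0 : ℝ) (n + 1), HasDerivWithinAt α (v t (α t)) (Icc (0 : ℝ) (n + 1)) t := by
    intro n
    have h0 : (0 : ℝ) ∈ Icc (0 : ℝ) (n + 1) := ⟨le_rfl, by positivity⟩
    have : IsPicardLindelof v (⟨0, h0⟩ : Icc (0 : ℝ) (n + 1)) x₀ (B * (n + 1)) 0 B L := by
      refine ⟨fun t _ => (hv t).lipschitzOnWith, fun y _ => (hc y).continuousOn,
        fun t _ y _ => hB t y, ?_⟩
      have : (0 : ℝ) ≤ n + 1 := by positivity
      simp [this]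
    exact this.exists_eq_forall_mem_Icc_hasDerivWithinAt₀
  choose α hα0 hα using hloc
  have hder : ∀ n : ℕ, ∀ t ∈ Ico (0 : ℝ) (n + 1),
      HasDerivWithinAt (α n) (v t (α n t)) (Ici 0) t := by
    intro n t ht
    refine (hα n t (Ico_subset_Icc_self ht)).mono_of_mem_nhdsWithin ?_
    have h1 : Iio ((n : ℝ) + 1) ∈ 𝓝[Ici 0] t := mem_nhdsWithin_of_mem_nhds (Iio_mem_nhds ht.2)
    filter_upwards [h1, self_mem_nhdsWithin] with u hu hu0 using ⟨hu0, le_of_lt hu⟩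
  have hagree : ∀ n k : ℕ, n ≤ k → ∀ t ∈ Ico (0 : ℝ) (n + 1), α n t = α k t := by
    intro n k hnk t ht
    have hnk' : (n : ℝ) ≤ k := by exact_mod_cast hnk
    have hcont : ∀ j : ℕ, n ≤ j → ContinuousOn (α j) (Icc 0 t) := by
      intro j hj u hu
      have hj' : (n : ℝ) ≤ j := by exact_mod_cast hj
      exact ((hder j u ⟨hu.1, by linarith [hu.2, ht.2]⟩).continuousWithinAt).mono
        Icc_subset_Ici_self
    have := dist_le_of_trajectories_ODE (a := 0) (b := t) (δ := 0) hv
      (hcont n le_rfl) (fun u hu => (hder n u ⟨hu.1, by linarith [hu.2, ht.2]⟩).mono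
        (Ici_subset_Ici.2 hu.1))
      (hcont k hnk) (fun u hu => (hder k u ⟨hu.1, by linarith [hu.2, ht.2]⟩).mono
        (Ici_subset_Ici.2 hu.1)) (by simp [hα0]) t ⟨ht.1, le_rfl⟩
    simpa using this
  refine ⟨fun t => α ⌊t⌋₊ t, by simp [hα0], fun t ht => ?_⟩
  have hlt := Nat.lt_floor_add_one t
  refine (hder ⌊t⌋₊ t ⟨ht, hlt⟩).congr_of_eventuallyEq ?_ rfl
  have h1 : Iio ((⌊t⌋₊ : ℝ) + 1) ∈ 𝓝[Ici 0] t := mem_nhdsWithin_of_mem_nhds (Iio_mem_nhds hlt)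
  filter_upwards [h1, self_mem_nhdsWithin] with u hu hu0
  have hle : ⌊u⌋₊ ≤ ⌊t⌋₊ := by
    have : ⌊u⌋₊ < ⌊t⌋₊ + 1 := (Nat.floor_lt hu0).2 (by push_cast; exact hu)
    omega
  exact hagree _ _ hle u ⟨hu0, Nat.lt_floor_add_one u⟩

/-- Along a bounded solution of an autonomous equation there is a limit solution. -/
theorem IsForwardSolution.exists_limit [ProperSpace E] [CompleteSpace E] {g : E → E} {L B : ℝ≥0}
    (hg : LipschitzWith L g) (hB : ∀ y, ‖g y‖ ≤ B) {η : ℝ → E} {R : ℝ}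
    (hη : IsForwardSolution (fun _ => g) η) (hR : ∀ t, 0 ≤ t → ‖η t‖ ≤ R) :
    ∃ (a : ℕ → ℝ) (ζ : ℝ → E), (∀ n, 0 ≤ a n) ∧ Tendsto a atTop atTop ∧
      IsForwardSolution (fun _ => g) ζ ∧
      ∀ s, 0 ≤ s → Tendsto (fun n => η (a n + s)) atTop (𝓝 (ζ s)) := by
  obtain ⟨z, -, φ, hφ, hz⟩ := (isCompact_closedBall (0 : E) R).tendsto_subseq
    (x := fun n : ℕ => η n) (fun n => mem_closedBall_zero_iff.2 (hR n (by positivity)))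
  obtain ⟨ζ, hζ0, hζ⟩ := exists_isForwardSolution (fun _ => hg) (fun _ => continuous_const)
    (fun _ => hB) z
  refine ⟨fun n => φ n, ζ, fun n => by positivity,
    tendsto_natCast_atTop_atTop.comp hφ.tendsto_atTop, hζ, fun s hs => ?_⟩
  rw [tendsto_iff_dist_tendsto_zero]
  -- Continuous dependence carries the convergence at `s = 0`, obtained by compactness, to every
  -- later `s`.
  have h1 : Tendsto (fun n => dist (η (φ n)) z * exp (L * s)) atTop (𝓝 0) := by
    have := (tendsto_iff_dist_tendsto_zero.1 hz).mul_const (exp (L * s))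
    simpa using this
  refine squeeze_zero (fun _ => dist_nonneg) (fun n => ?_) h1
  have := (hη.shift (s := φ n) (by positivity)).dist_le hζ (fun _ => hg) hs
  simpa [hζ0] using this

end ForwardSolutions

/-! ### Averaging and practical stability -/

section Averaging

open Set Filter Topology MeasureTheory intervalIntegral Real Metric

variable {E : Type*} [NormedAddCommGroup E] [NormedSpace ℝ E]

/-- Bounded, uniformly Lipschitz fields that are `2π`-periodic in the phase. -/
structure IsPeriodicField (Φ : E → ℝ → E) (L B : ℝ≥0) : Prop where
  lipschitz : ∀ φ, LipschitzWith L fun x => Φ x φ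
  continuous : ∀ x, Continuous (Φ x)
  bound : ∀ x φ, ‖Φ x φ‖ ≤ B
  periodic : ∀ x, Function.Periodic (Φ x) (2 * π)

/-- The average of a field over the phase. -/
noncomputable def avgField (Φ : E → ℝ → E) (x : E) : E :=
  (2 * π)⁻¹ • ∫ φ in (0 : ℝ)..(2 * π), Φ x φ

variable {Φ : E → ℝ → E} {L B : ℝ≥0}

namespace IsPeriodicField

theorem avgField_bound (h : IsPeriodicField Φ L B) (x : E) : ‖avgField Φ x‖ ≤ B := by
  have := intervalIntegral.norm_integral_le_of_norm_le_const (a := 0) (b := 2 * π)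
    (f := Φ x) (C := B) (fun φ _ => h.bound x φ)
  have hp : 0 < 2 * π := by positivity
  rw [avgField, norm_smul, norm_of_nonneg (by positivity), inv_mul_le_iff₀ hp]
  rw [sub_zero, abs_of_pos hp] at this
  linarith

theorem avgField_lipschitz (h : IsPeriodicField Φ L B) : LipschitzWith L (avgField Φ) := by
  refine LipschitzWith.of_dist_le_mul fun x y => ?_
  have hp : 0 < 2 * π := by positivity
  rw [dist_eq_norm, avgField, avgField, ← smul_sub, ← intervalIntegral.integral_sub
    ((h.continuous x).intervalIntegrable _ _) ((h.continuous y).intervalIntegrable _ _),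
    norm_smul, norm_of_nonneg (by positivity), inv_mul_le_iff₀ hp]
  have := intervalIntegral.norm_integral_le_of_norm_le_const (a := 0) (b := 2 * π)
    (f := fun φ => Φ x φ - Φ y φ) (C := L * dist x y)
    (fun φ _ => by rw [← dist_eq_norm]; exact (h.lipschitz φ).dist_le_mul x y)
  rw [sub_zero, abs_of_pos hp] at this
  linarith

theorem avgField_eq (h : IsPeriodicField Φ L B) (x : E) {ω : ℝ} (hω : 0 < ω) (t : ℝ) :
    avgField Φ x = (2 * π / ω)⁻¹ • ∫ u in t..(t + 2 * π / ω), Φ x (ω * u) := by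
  rw [intervalIntegral.integral_comp_mul_left (fun φ => Φ x φ) hω.ne', smul_smul, mul_add,
    mul_div_cancel₀ _ hω.ne', (h.periodic x).intervalIntegral_add_eq (ω * t) 0, zero_add, avgField]
  congr 1
  field_simp

/-- Solutions of a rapidly oscillating equation are close to those of the averaged equation. -/
theorem dist_le_averaged [CompleteSpace E] (h : IsPeriodicField Φ L B) {ω : ℝ} (hω : 0 < ω)
    {x η : ℝ → E} (hx : IsForwardSolution (fun t y => Φ y (ω * t)) x)
    (hη : IsForwardSolution (fun _ => avgField Φ) η) {s : ℝ} (hs : 0 ≤ s) (h0 : η 0 = x s)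
    {t T : ℝ} (ht : t ∈ Icc 0 T) :
    dist (x (s + t)) (η t) ≤ 2 * π / ω * (B + gronwallBound B L (2 * L * B) T) := by
  set τ := 2 * π / ω with hτ
  have hτ0 : 0 < τ := by positivity
  have hlip : ∀ a b : ℝ, 0 ≤ a → 0 ≤ b → ‖x b - x a‖ ≤ B * |b - a| := fun a b ha hb =>
    hx.norm_sub_le (fun _ _ => h.bound _ _) ha hb
  -- Extending `x` by a constant to negative times makes its primitive differentiable everywhere.
  set xe : ℝ → E := fun u => x (max u 0) with hxe
  have hxec : Continuous xe := by
    refine hx.continuousOn.comp_continuous (by fun_prop) fun u => mem_Ici.2 (le_max_right _ _)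
  have hxe_eq : ∀ u, 0 ≤ u → xe u = x u := fun u hu => by simp [hxe, hu]
  -- The moving average over one period `τ` stays within `B τ` of `x`, and its derivative is the
  -- mean of `Φ` along `x` over that period. Freezing the state at `X u` costs `O(τ)` and leaves
  -- exactly the averaged field, so `X` solves the averaged equation approximately and Grönwall
  -- applies.
  set X : ℝ → E := fun u => τ⁻¹ • ∫ w in (s + u)..(s + u + τ), xe w with hX
  have hXd : ∀ u, HasDerivAt X (τ⁻¹ • (xe (s + u + τ) - xe (s + u))) u := by
    intro u
    have hY : ∀ w, HasDerivAt (fun w => ∫ z in (0 : ℝ)..w, xe z) (xe w) w := fun w =>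
      intervalIntegral.integral_hasDerivAt_right (hxec.intervalIntegrable _ _)
        (hxec.stronglyMeasurableAtFilter _ _) hxec.continuousAt
    have e : X = fun u => τ⁻¹ • ((∫ z in (0 : ℝ)..(s + u + τ), xe z) -
        ∫ z in (0 : ℝ)..(s + u), xe z) := by
      ext u
      rw [hX, intervalIntegral.integral_interval_sub_left] <;>
        exact hxec.intervalIntegrable _ _
    rw [e]
    refine HasDerivAt.const_smul _ (HasDerivAt.sub ?_ ?_)
    · have h2 : HasDerivAt (fun u => s + u + τ) 1 u := ((hasDerivAt_id u).const_add s).add_const τ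
      have h3 := (hY (s + u + τ)).scomp u h2
      rw [one_smul] at h3
      exact h3
    · have h2 : HasDerivAt (fun u => s + u) 1 u := (hasDerivAt_id u).const_add s
      have h3 := (hY (s + u)).scomp u h2
      rw [one_smul] at h3
      exact h3
  have hXx : ∀ u, 0 ≤ u → ‖X u - x (s + u)‖ ≤ B * τ := by
    intro u hu
    have hsu : 0 ≤ s + u := add_nonneg hs hu
    have e : X u - x (s + u) = τ⁻¹ • ∫ w in (s + u)..(s + u + τ), (xe w - x (s + u)) := by
      rw [intervalIntegral.integral_sub (hxec.intervalIntegrable _ _) (by simp),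
        intervalIntegral.integral_const, add_sub_cancel_left, smul_sub, smul_smul,
        inv_mul_cancel₀ hτ0.ne', one_smul]
    rw [e, norm_smul, norm_of_nonneg (by positivity), inv_mul_le_iff₀ hτ0]
    have := intervalIntegral.norm_integral_le_of_norm_le_const (a := s + u) (b := s + u + τ)
      (f := fun w => xe w - x (s + u)) (C := B * τ) (fun w hw => by
        rw [uIoc_of_le (by linarith)] at hw
        have hw0 : 0 ≤ w := by linarith [hw.1]
        rw [hxe_eq w hw0]
        refine (hlip _ _ hsu hw0).trans ?_
        gcongr
        rw [abs_of_nonneg (by linarith [hw.1])]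
        linarith [hw.2])
    rw [add_sub_cancel_left, abs_of_pos hτ0] at this
    linarith
  have hΦc : Continuous fun p : E × ℝ => Φ p.1 p.2 := by
    exact continuous_prod_of_continuous_lipschitzWith (fun p : E × ℝ => Φ p.1 p.2) L
      (fun y => h.continuous y) (fun φ => h.lipschitz φ)
  have hXg : ∀ u, 0 ≤ u →
      dist (τ⁻¹ • (xe (s + u + τ) - xe (s + u))) (avgField Φ (X u)) ≤ 2 * L * B * τ := by
    intro u hu
    have hsu : 0 ≤ s + u := add_nonneg hs hu
    have hc1 : Continuous fun w => Φ (xe w) (ω * w) :=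
      hΦc.comp (hxec.prodMk (continuous_const.mul continuous_id))
    have hc2 : Continuous fun w => Φ (X u) (ω * w) :=
      (h.continuous (X u)).comp (continuous_const.mul continuous_id)
    have e1 : xe (s + u + τ) - xe (s + u) = ∫ w in (s + u)..(s + u + τ), Φ (xe w) (ω * w) := by
      symm
      apply intervalIntegral.integral_eq_sub_of_hasDeriv_right hxec.continuousOn _
        (hc1.intervalIntegrable _ _)
      intro w hw
      rw [min_eq_left (by linarith), max_eq_right (by linarith)] at hw
      have hw0 : 0 ≤ w := by linarith [hw.1]
      rw [hxe_eq w hw0]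
      refine ((hx w hw0).mono (Ioi_subset_Ici hw0)).congr (fun z hz => ?_) (hxe_eq w hw0)
      exact hxe_eq z (hw0.trans (le_of_lt hz))
    rw [dist_eq_norm, e1, h.avgField_eq (X u) hω (s + u), ← smul_sub,
      ← intervalIntegral.integral_sub (hc1.intervalIntegrable _ _) (hc2.intervalIntegrable _ _),
      norm_smul, norm_of_nonneg (by positivity), inv_mul_le_iff₀ hτ0]
    have := intervalIntegral.norm_integral_le_of_norm_le_const (a := s + u) (b := s + u + τ)
      (f := fun w => Φ (xe w) (ω * w) - Φ (X u) (ω * w)) (C := L * (2 * B * τ)) (fun w hw => by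
        rw [uIoc_of_le (by linarith)] at hw
        have hw0 : 0 ≤ w := by linarith [hw.1]
        rw [← dist_eq_norm]
        refine ((h.lipschitz _).dist_le_mul _ _).trans ?_
        gcongr
        rw [hxe_eq w hw0]
        refine (dist_triangle _ (x (s + u)) _).trans ?_
        have h1 := hlip _ _ hsu hw0
        have h2 := hXx u hu
        rw [dist_eq_norm, dist_eq_norm, norm_sub_rev (x (s + u))]
        have h3 : |w - (s + u)| ≤ τ := by
          rw [abs_of_nonneg (by linarith [hw.1])]
          linarith [hw.2]
        have h4 : (B : ℝ) * |w - (s + u)| ≤ B * τ := by gcongr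
        linarith)
    rw [add_sub_cancel_left, abs_of_pos hτ0] at this
    calc _ ≤ L * (2 * B * τ) * τ := this
      _ = _ := by ring
  have hgr := dist_le_of_approx_trajectories_ODE (a := 0) (b := T) (δ := B * τ)
    (v := fun _ => avgField Φ) (g' := fun u => avgField Φ (η u)) (εg := 0)
    (fun _ => h.avgField_lipschitz)
    (fun u _ => (hXd u).continuousAt.continuousWithinAt)
    (fun u _ => (hXd u).hasDerivWithinAt) (fun u hu => hXg u hu.1)
    (hη.continuousOn.mono Icc_subset_Ici_self) (fun u hu => hη.hasDerivWithinAt_Ici hu.1)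
    (fun u _ => by simp)
    (by rw [h0, dist_eq_norm]; simpa using hXx 0 le_rfl) t ht
  -- The Grönwall bound is linear in the initial error and the defect, both proportional to `τ`.
  have hgb : gronwallBound (B * τ) L (2 * L * B * τ + 0) T =
      τ * gronwallBound B L (2 * L * B) T := by
    unfold gronwallBound
    split_ifs <;> ring
  have hmono : gronwallBound (B * τ) L (2 * L * B * τ + 0) (t - 0) ≤
      gronwallBound (B * τ) L (2 * L * B * τ + 0) T :=
    gronwallBound_mono (by positivity) (by positivity) (by positivity) (by linarith [ht.2])
  have h1 := hXx t ht.1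
  rw [norm_sub_rev, ← dist_eq_norm] at h1
  calc dist (x (s + t)) (η t) ≤ dist (x (s + t)) (X t) + dist (X t) (η t) := dist_triangle _ _ _
    _ ≤ B * τ + τ * gronwallBound B L (2 * L * B) T := by linarith
    _ = _ := by ring

/-- The threshold frequency does not depend on the starting time `s`; this is what permits
restarting the comparison indefinitely. -/
theorem eventually_close [CompleteSpace E] (h : IsPeriodicField Φ L B) (T : ℝ) {ε : ℝ}
    (hε : 0 < ε) : ∃ ωs, 0 < ωs ∧ ∀ ω, ωs ≤ ω → ∀ x η : ℝ → E,
      IsForwardSolution (fun t y => Φ y (ω * t)) x → IsForwardSolution (fun _ => avgField Φ) η →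
      ∀ s, 0 ≤ s → η 0 = x s → ∀ t ∈ Icc 0 T, dist (x (s + t)) (η t) ≤ ε := by
  set C := (B : ℝ) + gronwallBound B L (2 * L * B) T
  refine ⟨max 1 (2 * π * C / ε), by positivity, fun ω hω x η hx hη s hs h0 t ht => ?_⟩
  have hω1 : 1 ≤ ω := (le_max_left _ _).trans hω
  have hω2 : 2 * π * C / ε ≤ ω := (le_max_right _ _).trans hω
  have hω0 : 0 < ω := by linarith
  refine (h.dist_le_averaged hω0 hx hη hs h0 ht).trans ?_
  rw [div_le_iff₀ hε] at hω2
  rw [div_mul_eq_mul_div, div_le_iff₀ hω0]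
  linarith

end IsPeriodicField

/-- Stability and pointwise attractivity are uniform on compact sets. -/
theorem exists_uniform_attraction_time [CompleteSpace E] {g : E → E} (hg : LipschitzWith L g)
    (hB : ∀ y, ‖g y‖ ≤ B) {A K : Set E} (hK : IsCompact K) {δ δ₁ : ℝ} (hδ₁ : 0 < δ₁)
    (hstab : ∀ η, IsForwardSolution (fun _ => g) η → infDist (η 0) A ≤ δ₁ →
      ∀ t, 0 ≤ t → infDist (η t) A ≤ δ)
    (hattr : ∀ η, IsForwardSolution (fun _ => g) η → η 0 ∈ K → ∀ ε, 0 < ε →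
      ∃ t, 0 ≤ t ∧ infDist (η t) A < ε) :
    ∃ T, ∀ η, IsForwardSolution (fun _ => g) η → η 0 ∈ K → ∀ t, T ≤ t → infDist (η t) A ≤ δ := by
  refine hK.induction_on (p := fun s => ∃ T, ∀ η, IsForwardSolution (fun _ => g) η → η 0 ∈ s →
    ∀ t, T ≤ t → infDist (η t) A ≤ δ) ?_ ?_ ?_ ?_
  · exact ⟨0, fun η _ h => absurd h (notMem_empty _)⟩
  · rintro s s' hss' ⟨T, hT⟩
    exact ⟨T, fun η hη h => hT η hη (hss' h)⟩
  · rintro s s' ⟨T, hT⟩ ⟨T', hT'⟩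
    refine ⟨max T T', fun η hη h t ht => ?_⟩
    rcases h with h | h
    · exact hT η hη h t ((le_max_left _ _).trans ht)
    · exact hT' η hη h t ((le_max_right _ _).trans ht)
  · intro y hy
    obtain ⟨ζ, hζ0, hζ⟩ := exists_isForwardSolution (fun _ => hg) (fun _ => continuous_const)
      (fun _ => hB) y
    obtain ⟨a, ha0, ha⟩ := hattr ζ hζ (by rwa [hζ0]) δ₁ hδ₁
    -- From this neighbourhood of `y`, continuous dependence brings every solution within `δ₁` of
    -- `A` at the common time `a`, after which stability takes over.
    refine ⟨{z | dist z y * exp (L * a) < δ₁ - infDist (ζ a) A}, mem_nhdsWithin_of_mem_nhds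
      (IsOpen.mem_nhds (isOpen_lt (by fun_prop) continuous_const) (by simpa using ha)),
      a, fun η hη h t ht => ?_⟩
    have h1 : dist (η a) (ζ a) ≤ dist (η 0) (ζ 0) * exp (L * a) := hη.dist_le hζ (fun _ => hg) ha0
    have h2 : infDist (η a) A ≤ infDist (ζ a) A + dist (η a) (ζ a) := infDist_le_infDist_add_dist
    rw [hζ0] at h1
    have h3 : dist (η 0) y * exp (L * a) < δ₁ - infDist (ζ a) A := h
    have := hstab _ (hη.shift ha0) (by simp only [add_zero]; linarith) (t - a) (by linarith)
    simpa using this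

/-- After a uniform time `T` averaged solutions are within `d / 2` of `A`, and true solutions stay
`d / 2` close to them on `[0, T]`. Hence the true solution is within `d` of `A` at time `T`, which
is again an admissible start; restarting covers all times, and stability limits the excursions
between restarts. The last conclusion controls the transient from `K`. -/
theorem IsPeriodicField.practical_stability [ProperSpace E] [CompleteSpace E]
    (h : IsPeriodicField Φ L B) {A K : Set E} (hA : IsCompact A) (hA' : A.Nonempty) (hK : IsCompact K)
    (hstab : ∀ δ, 0 < δ → ∃ δ₁, 0 < δ₁ ∧ ∀ η, IsForwardSolution (fun _ => avgField Φ) η →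
      infDist (η 0) A ≤ δ₁ → ∀ t, 0 ≤ t → infDist (η t) A ≤ δ)
    {δ₀ : ℝ} (hδ₀ : 0 < δ₀)
    (hattr : ∀ η, IsForwardSolution (fun _ => avgField Φ) η →
      (η 0 ∈ K ∨ infDist (η 0) A ≤ δ₀) → ∀ ε, 0 < ε → ∃ t, 0 ≤ t ∧ infDist (η t) A < ε)
    {δ : ℝ} (hδ : 0 < δ) :
    ∃ ωs, 0 < ωs ∧ ∀ ω, ωs ≤ ω → ∃ ε, 0 < ε ∧ ∃ T, 0 < T ∧
      ∀ x, IsForwardSolution (fun t y => Φ y (ω * t)) x →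
        (infDist (x 0) A ≤ ε → ∀ t, 0 ≤ t → infDist (x t) A ≤ δ) ∧
        (x 0 ∈ K → (∀ t, T ≤ t → infDist (x t) A ≤ δ) ∧
          ∀ t ∈ Icc 0 T, ∃ η, IsForwardSolution (fun _ => avgField Φ) η ∧ η 0 = x 0 ∧
            dist (x t) (η t) ≤ δ) := by
  have hg := h.avgField_lipschitz
  have hgB := h.avgField_bound
  obtain ⟨δ₁, hδ₁, hst⟩ := hstab (δ / 2) (by positivity)
  -- The three bounds serve stability between restarts, return to the region of attraction, and the
  -- final estimate `δ / 2 + d / 2 ≤ δ`.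
  set d := min δ₁ (min δ₀ δ) with hd
  have hd0 : 0 < d := by positivity
  obtain ⟨δ₂, hδ₂, hst₂⟩ := hstab (d / 2) (by positivity)
  have hmem : ∀ z, z ∈ cthickening δ₀ A ↔ infDist z A ≤ δ₀ := by
    intro z
    rw [mem_cthickening_iff, infDist]
    exact ENNReal.le_ofReal_iff_toReal_le (infEDist_ne_top hA') hδ₀.le
  obtain ⟨T₀, hT₀⟩ := exists_uniform_attraction_time hg hgB (hK.union (hA.cthickening (r := δ₀)))
    hδ₂ hst₂ (fun η hη h0 => hattr η hη (h0.imp id (hmem _).1))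
  set T := max T₀ 1 with hT
  have hT0 : 0 < T := lt_of_lt_of_le one_pos (le_max_right _ _)
  obtain ⟨ωs, hωs, hclose⟩ := h.eventually_close T (ε := d / 2) (by positivity)
  refine ⟨ωs, hωs, fun ω hω => ⟨d, hd0, T, hT0, fun x hx => ?_⟩⟩
  have hdδ₁ : d ≤ δ₁ := min_le_left _ _
  have hdδ₀ : d ≤ δ₀ := (min_le_right _ _).trans (min_le_left _ _)
  have hdδ : d ≤ δ := (min_le_right _ _).trans (min_le_right _ _)
  have hav : ∀ s, ∃ η, η 0 = x s ∧ IsForwardSolution (fun _ => avgField Φ) η := fun s =>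
    exists_isForwardSolution (fun _ => hg) (fun _ => continuous_const) (fun _ => hgB) (x s)
  have hend : ∀ s, 0 ≤ s → (x s ∈ K ∨ infDist (x s) A ≤ δ₀) → infDist (x (s + T)) A ≤ d := by
    intro s hs hxs
    obtain ⟨η, hη0, hη⟩ := hav s
    have h1 := hclose ω hω x η hx hη s hs hη0 T ⟨hT0.le, le_rfl⟩
    have h2 := hT₀ η hη (by rw [hη0]; exact hxs.imp id (hmem _).2) T (le_max_left _ _)
    have h3 : infDist (x (s + T)) A ≤ infDist (η T) A + dist (x (s + T)) (η T) :=
      infDist_le_infDist_add_dist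
    linarith
  have hmid : ∀ s, 0 ≤ s → infDist (x s) A ≤ d → ∀ t ∈ Icc 0 T, infDist (x (s + t)) A ≤ δ := by
    intro s hs hxs t ht
    obtain ⟨η, hη0, hη⟩ := hav s
    have h1 := hclose ω hω x η hx hη s hs hη0 t ht
    have h2 := hst η hη (by rw [hη0]; exact hxs.trans hdδ₁) t ht.1
    have h3 : infDist (x (s + t)) A ≤ infDist (η t) A + dist (x (s + t)) (η t) :=
      infDist_le_infDist_add_dist
    linarith
  have hforever : ∀ s, 0 ≤ s → infDist (x s) A ≤ d → ∀ t, s ≤ t → infDist (x t) A ≤ δ := by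
    intro s hs hxs t hst
    have hind : ∀ n : ℕ, infDist (x (s + n * T)) A ≤ d := by
      intro n
      induction n with
      | zero => simpa using hxs
      | succ n ih =>
        have := hend (s + n * T) (by positivity) (Or.inr (ih.trans hdδ₀))
        convert this using 3
        push_cast; ring
    set n := ⌊(t - s) / T⌋₊
    have hn1 : n * T ≤ t - s := by
      rw [← le_div_iff₀ hT0]
      exact Nat.floor_le (div_nonneg (by linarith) hT0.le)
    have hn2 : t - s < (n + 1) * T := by
      rw [← div_lt_iff₀ hT0]
      exact Nat.lt_floor_add_one _
    have := hmid (s + n * T) (by positivity) (hind n) (t - s - n * T)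
      ⟨by linarith, by linarith⟩
    rwa [show s + n * T + (t - s - n * T) = t by ring] at this
  refine ⟨fun h0 t ht => hforever 0 le_rfl h0 t ht, fun h0 => ⟨fun t ht => ?_, fun t ht => ?_⟩⟩
  · have := hend 0 le_rfl (Or.inl h0)
    rw [zero_add] at this
    exact hforever T hT0.le this t ht
  · obtain ⟨η, hη0, hη⟩ := hav 0
    refine ⟨η, hη, hη0, ?_⟩
    have := hclose ω hω x η hx hη 0 le_rfl hη0 t ht
    rw [zero_add] at this
    linarith

end Averaging

/-! ### Comparison with barriers for finite families -/

section Barrier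

open Set Filter Topology

variable {ι : Type*} [Finite ι]

/-- A finite family of functions cannot cross an upper barrier if each of them grows strictly
slower than the barrier at the moment of contact. -/
theorem le_barrier {u u' : ι → ℝ → ℝ} {b b' : ℝ → ℝ} {t₀ t₁ : ℝ}
    (hu : ∀ i, ContinuousOn (u i) (Icc t₀ t₁)) (hb : ContinuousOn b (Icc t₀ t₁))
    (hu' : ∀ i, ∀ t ∈ Ico t₀ t₁, HasDerivWithinAt (u i) (u' i t) (Ici t) t)
    (hb' : ∀ t ∈ Ico t₀ t₁, HasDerivWithinAt b (b' t) (Ici t) t)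
    (h0 : ∀ i, u i t₀ ≤ b t₀)
    (h : ∀ t ∈ Ico t₀ t₁, (∀ j, u j t ≤ b t) → ∀ i, u i t = b t → u' i t < b' t) :
    ∀ t ∈ Icc t₀ t₁, ∀ i, u i t ≤ b t := by
  have hclosed : IsClosed ({t | ∀ i, u i t ≤ b t} ∩ Icc t₀ t₁) := by
    have : {t | ∀ i, u i t ≤ b t} ∩ Icc t₀ t₁ =
        Icc t₀ t₁ ∩ ⋂ i, {t ∈ Icc t₀ t₁ | u i t ≤ b t} := by
      ext t; simp only [mem_inter_iff, mem_ofPred_eq, mem_iInter]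
      exact ⟨fun h => ⟨h.2, fun i => ⟨h.2, h.1 i⟩⟩, fun h => ⟨fun i => (h.2 i).2, h.1⟩⟩
    rw [this]
    exact isClosed_Icc.inter (isClosed_iInter fun i => isClosed_Icc.isClosed_le (hu i) hb)
  refine hclosed.Icc_subset_of_forall_mem_nhdsWithin h0 ?_
  rintro t ⟨ht, htI⟩
  change ∀ᶠ s in 𝓝[>] t, ∀ i, u i s ≤ b s
  rw [eventually_all]
  intro i
  rcases (ht i).eq_or_lt with heq | hlt
  · have hd := (hb' t htI).sub (hu' i t htI)
    have hlt : 0 < b' t - u' i t := sub_pos.2 (h t htI ht i heq)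
    have hs := (hasDerivWithinAt_iff_tendsto_slope' self_notMem_Ioi).1 hd.Ioi_of_Ici
    filter_upwards [hs.eventually (lt_mem_nhds hlt), self_mem_nhdsWithin] with s hs1 hs2
    rw [slope_def_field, div_pos_iff_of_pos_right (sub_pos.2 hs2)] at hs1
    simp only [Pi.sub_apply, heq, sub_self, sub_zero] at hs1
    linarith
  · have h1 := (hu' i t htI).continuousWithinAt.mono Ioi_subset_Ici_self
    have h2 := (hb' t htI).continuousWithinAt.mono Ioi_subset_Ici_self
    filter_upwards [h1.eventually_lt h2 hlt] with s hs using hs.le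

/-- A finite family whose maximum decreases at a definite rate while it is in `[l, h]` is
eventually below `l`. -/
theorem eventually_le_of_decreasing {u u' : ι → ℝ → ℝ} {l h c : ℝ} (hc : 0 < c) (hlh : l ≤ h)
    (hu : ∀ i t, 0 ≤ t → HasDerivWithinAt (u i) (u' i t) (Ici 0) t) (h0 : ∀ i, u i 0 ≤ h)
    (hdec : ∀ t, 0 ≤ t → ∀ b ∈ Icc l h, (∀ j, u j t ≤ b) → ∀ i, u i t = b → u' i t ≤ -c) :
    ∃ T, 0 ≤ T ∧ ∀ t, T ≤ t → ∀ i, u i t ≤ l := by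
  have hcont : ∀ i, ContinuousOn (u i) (Ici 0) := fun i t ht => (hu i t ht).continuousWithinAt
  have hr : ∀ i t, 0 ≤ t → HasDerivWithinAt (u i) (u' i t) (Ici t) t := fun i t ht =>
    (hu i t ht).mono (Ici_subset_Ici.2 ht)
  -- The barrier descends at speed `c / 2`, so that the decrease at rate `c` is strictly faster at
  -- contact.
  set T := (h - l) / (c / 2) with hT
  have hT0 : 0 ≤ T := div_nonneg (by linarith) (by linarith)
  have hTl : h - c / 2 * T = l := by rw [hT]; field_simp; ring
  have h1 := le_barrier (t₀ := 0) (t₁ := T) (u := u) (u' := u') (b := fun t => h - c / 2 * t)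
    (b' := fun _ => -(c / 2)) (fun i => (hcont i).mono Icc_subset_Ici_self) (by fun_prop)
    (fun i t ht => hr i t ht.1)
    (fun t _ => by simpa using (((hasDerivAt_id t).const_mul (c / 2)).const_sub h).hasDerivWithinAt)
    (by simpa using h0)
    (fun t ht hle i hi => by
      have := hdec t ht.1 (h - c / 2 * t) ⟨by nlinarith [ht.2], by nlinarith [ht.1]⟩ hle i hi
      linarith)
  refine ⟨T, hT0, fun t ht => ?_⟩
  have h2 := le_barrier (t₀ := T) (t₁ := t) (u := u) (u' := u') (b := fun _ => l)
    (b' := fun _ => 0) (fun i => (hcont i).mono fun s hs => hT0.trans hs.1) (by fun_prop)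
    (fun i s hs => hr i s (hT0.trans hs.1)) (fun s _ => hasDerivWithinAt_const _ _ _)
    (fun i => by have := h1 T ⟨hT0, le_rfl⟩ i; linarith)
    (fun s hs hle i hi => by
      have := hdec s (hT0.trans hs.1) l ⟨le_rfl, hlh⟩ hle i hi
      linarith)
  exact h2 t ⟨ht, le_rfl⟩

end Barrier

/-! ### Invariant sets of the averaged array -/

section Array

open Set Filter Topology
open scoped RealInnerProductSpace

variable {ι : Type*} [Fintype ι] {V : Type*} [NormedAddCommGroup V] [InnerProductSpace ℝ V]

/-- The velocity of the `i`-th component of an array with damping coefficient `k` and coupling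
coefficients `c i j`. -/
def arrayVelocity (k : ℝ → ℝ) (c : ι → ι → ℝ → ℝ) (z : ι → V) (i : ι) : V :=
  -(k ‖z i‖) • z i + ∑ j, c i j ‖z j - z i‖ • (z j - z i)

/-- Damping with a sign change at the amplitude `ρ` and nonnegative coupling coefficients. -/
structure IsArrayCoeff (k : ℝ → ℝ) (c : ι → ι → ℝ → ℝ) (ρ : ℝ) : Prop where
  pos : 0 < ρ
  continuous : Continuous k
  damping_neg : ∀ s, 0 < s → s < ρ → k s < 0
  damping_pos : ∀ s, ρ < s → 0 < k s
  coupling_nonneg : ∀ i j s, 0 ≤ s → 0 ≤ c i j s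
  coupling_bound : ∀ i j R, ∃ C, ∀ s, 0 ≤ s → s ≤ R → c i j s ≤ C

/-- Solutions on `[0, ∞)` of the autonomous array. -/
def IsArraySolution (k : ℝ → ℝ) (c : ι → ι → ℝ → ℝ) (y : ι → ℝ → V) : Prop :=
  ∀ i t, 0 ≤ t → HasDerivWithinAt (y i) (arrayVelocity k c (fun j => y j t) i) (Ici 0) t

variable {k : ℝ → ℝ} {c : ι → ι → ℝ → ℝ} {ρ M : ℝ}

/-- At a component of norm `M > ρ` the damping points inwards, and so does the coupling to
components of the same ball. The velocity is prescribed only while all norms are at most `M`, so the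
bound also applies to truncated fields before the truncation is known to be inactive. -/
theorem IsArrayCoeff.norm_le (hkc : IsArrayCoeff k c ρ) {y y' : ι → ℝ → V} (hM : ρ < M)
    (hy : ∀ i t, 0 ≤ t → HasDerivWithinAt (y i) (y' i t) (Ici 0) t)
    (hy' : ∀ t, 0 ≤ t → (∀ j, ‖y j t‖ ≤ M) → ∀ i, y' i t = arrayVelocity k c (fun j => y j t) i)
    (h0 : ∀ i, ‖y i 0‖ ≤ M) {t : ℝ} (ht : 0 ≤ t) (i : ι) : ‖y i t‖ ≤ M := by
  have hM0 : 0 < M := hkc.pos.trans hM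
  have hd : ∀ i t, 0 ≤ t →
      HasDerivWithinAt (fun s => ‖y i s‖ ^ 2) (2 * ⟪y i t, y' i t⟫) (Ici 0) t :=
    fun i t ht => (hy i t ht).norm_sq
  have key := le_barrier (t₀ := 0) (t₁ := t) (u := fun i s => ‖y i s‖ ^ 2)
    (u' := fun i s => 2 * ⟪y i s, y' i s⟫) (b := fun _ => M ^ 2) (b' := fun _ => 0)
    (fun i s hs => (hd i s hs.1).continuousWithinAt.mono Icc_subset_Ici_self) (by fun_prop)
    (fun i s hs => (hd i s hs.1).mono (Ici_subset_Ici.2 hs.1))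
    (fun s _ => hasDerivWithinAt_const _ _ _)
    (fun i => pow_le_pow_left₀ (norm_nonneg _) (h0 i) 2) ?_ t ⟨ht, le_rfl⟩ i
  · exact (sq_le_sq₀ (norm_nonneg _) hM0.le).1 key
  · intro s hs hle i hi
    have hle' : ∀ j, ‖y j s‖ ≤ M := fun j => (sq_le_sq₀ (norm_nonneg _) hM0.le).1 (hle j)
    have hi' : ‖y i s‖ = M := (sq_eq_sq₀ (norm_nonneg _) hM0.le).1 hi
    rw [hy' s hs.1 hle' i, arrayVelocity, inner_add_right, inner_smul_right, inner_sum, hi',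
      real_inner_self_eq_norm_sq, hi']
    have hsum : ∑ j, ⟪y i s, c i j ‖y j s - y i s‖ • (y j s - y i s)⟫ ≤ 0 := by
      refine Finset.sum_nonpos fun j _ => ?_
      rw [inner_smul_right, inner_sub_right, real_inner_self_eq_norm_sq, hi']
      have h1 := hkc.coupling_nonneg i j _ (norm_nonneg (y j s - y i s))
      have h2 := real_inner_le_norm (y i s) (y j s)
      rw [hi'] at h2
      have h3 : M * ‖y j s‖ ≤ M * M := by gcongr; exact hle' j
      exact mul_nonpos_of_nonneg_of_nonpos h1 (by nlinarith)
    have := mul_pos (hkc.damping_pos M hM) (pow_pos hM0 2)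
    nlinarith

namespace IsArraySolution

variable {y : ι → ℝ → V}

theorem shift (hy : IsArraySolution k c y) {s : ℝ} (hs : 0 ≤ s) :
    IsArraySolution k c fun i t => y i (s + t) := by
  intro i t ht
  have h1 := hy i (s + t) (add_nonneg hs ht)
  have h2 : HasDerivWithinAt (fun t => s + t) 1 (Ici 0) t :=
    ((hasDerivAt_id t).const_add s).hasDerivWithinAt
  have := h1.scomp t h2 (fun u hu => mem_Ici.2 (add_nonneg hs hu))
  rw [one_smul] at this
  exact this

theorem hasDerivWithinAt_inner (hy : IsArraySolution k c y) (n : V) (i : ι) {t : ℝ} (ht : 0 ≤ t) :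
    HasDerivWithinAt (fun s => ⟪n, y i s⟫) (-(k ‖y i t‖) * ⟪n, y i t⟫ +
      ∑ j, c i j ‖y j t - y i t‖ * (⟪n, y j t⟫ - ⟪n, y i t⟫)) (Ici 0) t := by
  have := (innerSL ℝ n).hasFDerivAt.comp_hasDerivWithinAt t (hy i t ht)
  refine HasDerivWithinAt.congr_deriv this ?_
  simp [arrayVelocity, inner_add_right, inner_smul_right, inner_sum, inner_sub_right]

theorem continuousOn_inner (hy : IsArraySolution k c y) (n : V) (i : ι) :
    ContinuousOn (fun s => ⟪n, y i s⟫) (Ici 0) :=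
  fun _ ht => (hy.hasDerivWithinAt_inner n i ht).continuousWithinAt

theorem norm_le (hkc : IsArrayCoeff k c ρ) (hy : IsArraySolution k c y) (hM : ρ < M)
    (h0 : ∀ i, ‖y i 0‖ ≤ M) {t : ℝ} (ht : 0 ≤ t) (i : ι) : ‖y i t‖ ≤ M :=
  hkc.norm_le hM hy (fun _ _ _ _ => rfl) h0 ht i

/-- Half-planes through the origin are invariant. -/
theorem inner_nonpos (hkc : IsArrayCoeff k c ρ) (hy : IsArraySolution k c y)
    (hM : ∀ i t, 0 ≤ t → ‖y i t‖ ≤ M) {n : V} (h0 : ∀ i, ⟪n, y i 0⟫ ≤ 0) {t : ℝ} (ht : 0 ≤ t)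
    (i : ι) : ⟪n, y i t⟫ ≤ 0 := by
  obtain ⟨K, hK⟩ := (isCompact_Icc (a := 0) (b := M)).exists_bound_of_continuousOn
    hkc.continuous.continuousOn
  -- With `|k| ≤ K` the functional grows at rate at most `K` at contact, strictly below the
  -- barrier's rate `K + 1`; then `ε` tends to zero.
  have key : ∀ ε, 0 < ε → ⟪n, y i t⟫ ≤ ε * Real.exp ((K + 1) * t) := by
    intro ε hε
    have hbd : ∀ s, HasDerivAt (fun s => ε * Real.exp ((K + 1) * s))
        (ε * (Real.exp ((K + 1) * s) * (K + 1))) s := by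
      intro s
      have h1 : HasDerivAt (fun s => (K + 1) * s) (K + 1) s := by
        simpa using (hasDerivAt_id s).const_mul (K + 1)
      exact (h1.exp).const_mul ε
    refine le_barrier (t₀ := 0) (t₁ := t) (u := fun i s => ⟪n, y i s⟫)
      (b := fun s => ε * Real.exp ((K + 1) * s))
      (fun i => (hy.continuousOn_inner n i).mono Icc_subset_Ici_self) (by fun_prop)
      (fun i s hs => (hy.hasDerivWithinAt_inner n i hs.1).mono (Ici_subset_Ici.2 hs.1))
      (fun s _ => (hbd s).hasDerivWithinAt)
      (fun i => (h0 i).trans (by positivity)) ?_ t ⟨ht, le_rfl⟩ i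
    intro s hs hle i hi
    have hsum : ∑ j, c i j ‖y j s - y i s‖ * (⟪n, y j s⟫ - ⟪n, y i s⟫) ≤ 0 :=
      Finset.sum_nonpos fun j _ => mul_nonpos_of_nonneg_of_nonpos
        (hkc.coupling_nonneg i j _ (norm_nonneg _)) (by rw [hi]; linarith [hle j])
    have hk := (abs_le.1 (hK ‖y i s‖ ⟨norm_nonneg _, hM i s hs.1⟩)).1
    have hpos : 0 < ε * Real.exp ((K + 1) * s) := by positivity
    rw [hi] at hsum ⊢
    nlinarith
  have hlim : Tendsto (fun ε => ε * Real.exp ((K + 1) * t)) (𝓝[>] 0) (𝓝 0) := by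
    have : Continuous fun ε : ℝ => ε * Real.exp ((K + 1) * t) := by fun_prop
    exact (this.tendsto' 0 0 (by simp)).mono_left nhdsWithin_le_nhds
  exact ge_of_tendsto hlim (by filter_upwards [self_mem_nhdsWithin] with ε hε using key ε hε)

/-- In a cone about `w`, the components stay away from the origin. -/
theorem le_inner (hkc : IsArrayCoeff k c ρ) (hy : IsArraySolution k c y) {w : V} {C p : ℝ}
    (hcone : ∀ i t, 0 ≤ t → ‖y i t‖ ≤ C * ⟪w, y i t⟫) (hp : 0 < p) (hpC : C * p < ρ)
    (h0 : ∀ i, p ≤ ⟪w, y i 0⟫) {t : ℝ} (ht : 0 ≤ t) (i : ι) : p ≤ ⟪w, y i t⟫ := by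
  have key := le_barrier (t₀ := 0) (t₁ := t) (u := fun i s => -⟪w, y i s⟫) (b := fun _ => -p)
    (b' := fun _ => 0)
    (fun i => ((hy.continuousOn_inner w i).mono Icc_subset_Ici_self).neg) (by fun_prop)
    (fun i s hs => ((hy.hasDerivWithinAt_inner w i hs.1).mono (Ici_subset_Ici.2 hs.1)).neg)
    (fun s _ => hasDerivWithinAt_const _ _ _)
    (fun i => by simpa using h0 i) ?_ t ⟨ht, le_rfl⟩ i
  · simpa using key
  · intro s hs hle i hi
    have hi' : ⟪w, y i s⟫ = p := by simpa using hi
    have hle' : ∀ j, p ≤ ⟪w, y j s⟫ := fun j => by simpa using hle j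
    have hsum : 0 ≤ ∑ j, c i j ‖y j s - y i s‖ * (⟪w, y j s⟫ - ⟪w, y i s⟫) :=
      Finset.sum_nonneg fun j _ => mul_nonneg
        (hkc.coupling_nonneg i j _ (norm_nonneg _)) (by rw [hi']; linarith [hle' j])
    have hn : 0 < ‖y i s‖ := by
      rw [norm_pos_iff]
      intro h
      rw [h, inner_zero_right] at hi'
      exact hp.ne hi'
    -- At contact the cone gives `‖y i s‖ ≤ C p < ρ`, so the damping is negative and pushes
    -- outwards.
    have hk := hkc.damping_neg ‖y i s‖ hn ((hcone i s hs.1).trans_lt (by rwa [hi']))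
    rw [hi'] at hsum ⊢
    nlinarith

/-- A linear functional that is nonnegative on all components and positive on the `i`-th one
remains positive there. -/
theorem inner_pos_of_inner_pos (hkc : IsArrayCoeff k c ρ) (hy : IsArraySolution k c y)
    (hM : ∀ i t, 0 ≤ t → ‖y i t‖ ≤ M) {n : V} (hn : ∀ i t, 0 ≤ t → 0 ≤ ⟪n, y i t⟫) {i : ι}
    {s t : ℝ} (hs : 0 ≤ s) (hst : s ≤ t) (h0 : 0 < ⟪n, y i s⟫) : 0 < ⟪n, y i t⟫ := by
  obtain ⟨K, hK⟩ := (isCompact_Icc (a := 0) (b := M)).exists_bound_of_continuousOn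
    hkc.continuous.continuousOn
  choose C hC using fun j => hkc.coupling_bound i j (M + M)
  -- Damping and coupling losses are at most `K` and `∑ C j`; the extra `1` makes the exponential
  -- lower barrier strict.
  set D := K + ∑ j, C j + 1
  have hbd : ∀ r, HasDerivAt (fun r => -(⟪n, y i s⟫ * Real.exp (-D * (r - s))))
      (-(⟪n, y i s⟫ * (Real.exp (-D * (r - s)) * -D))) r := by
    intro r
    have h1 : HasDerivAt (fun r => -D * (r - s)) (-D) r := by
      simpa using ((hasDerivAt_id r).sub_const s).const_mul (-D)
    exact ((h1.exp).const_mul _).neg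
  have key := le_barrier (ι := Unit) (t₀ := s) (t₁ := t) (u := fun _ r => -⟪n, y i r⟫)
    (b := fun r => -(⟪n, y i s⟫ * Real.exp (-D * (r - s))))
    (fun _ => ((hy.continuousOn_inner n i).mono fun r hr => hs.trans hr.1).neg) (by fun_prop)
    (fun _ r hr => ((hy.hasDerivWithinAt_inner n i (hs.trans hr.1)).mono
      (Ici_subset_Ici.2 (hs.trans hr.1))).neg)
    (fun r _ => (hbd r).hasDerivWithinAt) (fun _ => by simp) ?_ t ⟨hst, le_rfl⟩ ()
  · have : 0 < ⟪n, y i s⟫ * Real.exp (-D * (t - s)) := by positivity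
    linarith
  · intro r hr _ _ hi
    have hr0 : 0 ≤ r := hs.trans hr.1
    have hi' : ⟪n, y i r⟫ = ⟪n, y i s⟫ * Real.exp (-D * (r - s)) := by simpa using hi
    set h := ⟪n, y i s⟫ * Real.exp (-D * (r - s)) with hh
    have hpos : 0 < h := by positivity
    have hk := (abs_le.1 (hK ‖y i r‖ ⟨norm_nonneg _, hM i r hr0⟩)).2
    have hsum : -((∑ j, C j) * h) ≤
        ∑ j, c i j ‖y j r - y i r‖ * (⟪n, y j r⟫ - ⟪n, y i r⟫) := by
      rw [Finset.sum_mul, ← Finset.sum_neg_distrib]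
      refine Finset.sum_le_sum fun j _ => ?_
      have h1 := hkc.coupling_nonneg i j _ (norm_nonneg (y j r - y i r))
      have h2 := hC j _ (norm_nonneg (y j r - y i r))
        ((norm_sub_le _ _).trans (add_le_add (hM j r hr0) (hM i r hr0)))
      have h3 := hn j r hr0
      rw [hi']
      nlinarith
    have e : -(⟪n, y i s⟫ * (Real.exp (-D * (r - s)) * -D)) = D * h := by rw [hh]; ring
    rw [e, hi']
    rw [hi'] at hsum
    have : D * h = K * h + (∑ j, C j) * h + h := by ring
    nlinarith

/-- A linear functional that is nonnegative on all components and vanishes along the `i`-th one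
vanishes along all components that are coupled into it. -/
theorem inner_eq_zero_of_edge (hkc : IsArrayCoeff k c ρ) (hy : IsArraySolution k c y) {n : V}
    (hn : ∀ i t, 0 ≤ t → 0 ≤ ⟪n, y i t⟫) {i j : ι} (hij : ∀ s, 0 < s → 0 < c i j s)
    (hi : ∀ t, 0 ≤ t → ⟪n, y i t⟫ = 0) {t : ℝ} (ht : 0 ≤ t) : ⟪n, y j t⟫ = 0 := by
  have h1 := hy.hasDerivWithinAt_inner n i ht
  have h2 : HasDerivWithinAt (fun s => ⟪n, y i s⟫) 0 (Ici 0) t :=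
    (hasDerivWithinAt_const t (Ici 0) (0 : ℝ)).congr (fun s hs => hi s hs) (hi t ht)
  have h3 := (uniqueDiffOn_Ici (0 : ℝ) t ht).eq_deriv _ h1 h2
  simp only [hi t ht, mul_zero, zero_add, sub_zero] at h3
  have h4 := (Finset.sum_eq_zero_iff_of_nonneg fun j _ => mul_nonneg
    (hkc.coupling_nonneg i j _ (norm_nonneg _)) (hn j t ht)).1 h3 j (Finset.mem_univ j)
  rcases mul_eq_zero.1 h4 with h5 | h5
  · by_contra hne
    have : y j t - y i t ≠ 0 := by
      intro h
      rw [sub_eq_zero.1 h] at hne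
      exact hne (hi t ht)
    exact (hij _ (norm_pos_iff.2 this)).ne' h5
  · exact h5

end IsArraySolution

end Array

/-! ### Limit slopes and convergence of amplitudes -/

section Array

open Set Filter Topology
open scoped RealInnerProductSpace

variable {ι : Type*} [Fintype ι] {V : Type*} [NormedAddCommGroup V] [InnerProductSpace ℝ V]
  {k : ℝ → ℝ} {c : ι → ι → ℝ → ℝ} {ρ M : ℝ}

/-- A linear functional that is nonnegative on all components and always vanishes on some component
vanishes identically along the root of the coupling graph. -/
theorem IsArraySolution.inner_root_eq_zero (hkc : IsArrayCoeff k c ρ) {y : ι → ℝ → V}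
    (hy : IsArraySolution k c y) (hM : ∀ i t, 0 ≤ t → ‖y i t‖ ≤ M) {edge : ι → ι → Prop}
    (hedge : ∀ i j, edge i j → ∀ s, 0 < s → 0 < c i j s) {r : ι}
    (hr : ∀ i, Relation.ReflTransGen edge i r) {n : V} (hn : ∀ i t, 0 ≤ t → 0 ≤ ⟪n, y i t⟫)
    (hz : ∀ t, 0 ≤ t → ∃ i, ⟪n, y i t⟫ = 0) : ∀ t, 0 ≤ t → ⟪n, y r t⟫ = 0 := by
  -- Were each component positive at some time, positivity would persist and all would be positive
  -- at a common later time, contrary to `hz`.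
  have h1 : ∃ i, ∀ t, 0 ≤ t → ⟪n, y i t⟫ = 0 := by
    by_contra! hcon
    choose a ha0 ha using hcon
    obtain ⟨b, hb⟩ := Finite.exists_le a
    obtain ⟨i, hi⟩ := hz b ((ha0 r).trans (hb r))
    exact (hy.inner_pos_of_inner_pos hkc hM hn (ha0 i) (hb i)
      ((hn i _ (ha0 i)).lt_of_ne' (ha i))).ne' hi
  obtain ⟨i, hi⟩ := h1
  have h2 : ∀ j, Relation.ReflTransGen edge i j → ∀ t, 0 ≤ t → ⟪n, y j t⟫ = 0 := by
    intro j hj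
    induction hj with
    | refl => exact hi
    | tail _ hjk ih => exact fun t ht => hy.inner_eq_zero_of_edge hkc hn (hedge _ _ hjk) ih ht
  exact h2 r (hr i)

/-- Along a limit solution the largest slope `⟪v, ·⟫ / ⟪u, ·⟫` is constant, and the root attains
it. -/
theorem IsArraySolution.exists_slope_limit (hkc : IsArrayCoeff k c ρ) {y ζ : ι → ℝ → V}
    (hy : IsArraySolution k c y) (hζ : IsArraySolution k c ζ)
    (hM : ∀ i t, 0 ≤ t → ‖y i t‖ ≤ M) {u v : V} {p : ℝ} (hp : 0 < p)
    (hu : ∀ i t, 0 ≤ t → p ≤ ⟪u, y i t⟫) {a : ℕ → ℝ} (ha : Tendsto a atTop atTop)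
    (hlim : ∀ i s, 0 ≤ s → Tendsto (fun n => y i (a n + s)) atTop (𝓝 (ζ i s)))
    {edge : ι → ι → Prop} (hedge : ∀ i j, edge i j → ∀ s, 0 < s → 0 < c i j s) {r : ι}
    (hr : ∀ i, Relation.ReflTransGen edge i r) :
    ∃ W, (∀ i s, 0 ≤ s → ⟪v, ζ i s⟫ ≤ W * ⟪u, ζ i s⟫) ∧
      ∀ s, 0 ≤ s → ⟪v, ζ r s⟫ = W * ⟪u, ζ r s⟫ := by
  have hlimi : ∀ n : V, ∀ i s, 0 ≤ s →
      Tendsto (fun m => ⟪n, y i (a m + s)⟫) atTop (𝓝 ⟪n, ζ i s⟫) := fun n i s hs =>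
    tendsto_const_nhds.inner (hlim i s hs)
  have hev : ∀ b s : ℝ, ∀ᶠ m in atTop, b ≤ a m + s := fun b s => by
    filter_upwards [ha.eventually_ge_atTop (b - s)] with m hm
    linarith
  have hζM : ∀ i s, 0 ≤ s → ‖ζ i s‖ ≤ M := fun i s hs =>
    le_of_tendsto (hlim i s hs).norm ((hev 0 s).mono fun m hm => hM i _ hm)
  have hζu : ∀ i s, 0 ≤ s → p ≤ ⟪u, ζ i s⟫ := fun i s hs =>
    ge_of_tendsto (hlimi u i s hs) ((hev 0 s).mono fun m hm => hu i _ hm)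
  have hbd : ∀ i t, 0 ≤ t → |⟪v, y i t⟫| ≤ ‖v‖ * M := fun i t ht =>
    (abs_real_inner_le_norm _ _).trans (by gcongr; exact hM i t ht)
  have hM0 : 0 ≤ M := (norm_nonneg _).trans (hM r 0 le_rfl)
  -- By invariance of half-planes, a slope bound valid at one time is valid ever after. So `sInf S`
  -- is the limit of the decreasing maximal slope.
  set S : Set ℝ := {W | ∃ t, 0 ≤ t ∧ ∀ i, ⟪v, y i t⟫ ≤ W * ⟪u, y i t⟫} with hS
  have hSne : S.Nonempty := by
    refine ⟨‖v‖ * M / p, 0, le_rfl, fun i => ?_⟩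
    have h1 := (abs_le.1 (hbd i 0 le_rfl)).2
    have h2 := hu i 0 le_rfl
    have h3 : ‖v‖ * M = ‖v‖ * M / p * p := by field_simp
    have h4 : ‖v‖ * M / p * p ≤ ‖v‖ * M / p * ⟪u, y i 0⟫ := by gcongr
    linarith
  have hSbd : BddBelow S := by
    refine ⟨-(‖v‖ * M / p), ?_⟩
    rintro W ⟨t, ht, hW⟩
    by_contra! hlt
    have h1 := (abs_le.1 (hbd r t ht)).1
    have h2 := hu r t ht
    have h3 : ‖v‖ * M = ‖v‖ * M / p * p := by field_simp
    have h4 : 0 ≤ ‖v‖ * M / p := by positivity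
    have h5 := hW r
    nlinarith
  have hupper : ∀ i s, 0 ≤ s → ⟪v, ζ i s⟫ ≤ sInf S * ⟪u, ζ i s⟫ := by
    intro i s hs
    have hpos : 0 < ⟪u, ζ i s⟫ := hp.trans_le (hζu i s hs)
    rw [← div_le_iff₀ hpos]
    refine le_csInf hSne ?_
    rintro W ⟨t, ht, hW⟩
    rw [div_le_iff₀ hpos]
    have hinv : ∀ t', t ≤ t' → ⟪v, y i t'⟫ ≤ W * ⟪u, y i t'⟫ := by
      intro t' ht'
      have := (hy.shift ht).inner_nonpos hkc (M := M) (n := v - W • u)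
        (fun j q hq => hM j _ (add_nonneg ht hq))
        (fun j => by
          have := hW j
          simp only [add_zero, inner_sub_left, inner_smul_left]
          simpa using this) (sub_nonneg.2 ht') i
      simp only [add_sub_cancel, inner_sub_left, inner_smul_left] at this
      simpa using this
    exact le_of_tendsto_of_tendsto (hlimi v i s hs) ((hlimi u i s hs).const_mul W)
      ((hev t s).mono fun m hm => hinv _ hm)
  refine ⟨sInf S, hupper, ?_⟩
  have hinner : ∀ i s, ⟪sInf S • u - v, ζ i s⟫ = sInf S * ⟪u, ζ i s⟫ - ⟪v, ζ i s⟫ := by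
    intro i s
    simp [inner_sub_left, inner_smul_left]
  have hroot := hζ.inner_root_eq_zero hkc hζM hedge hr (n := sInf S • u - v)
    (fun i t ht => by rw [hinner]; linarith [hupper i t ht]) ?_
  · intro s hs
    have := hroot s hs
    rw [hinner] at this
    linarith
  · intro s hs
    -- If every slope of the limit solution were below `sInf S` at time `s`, some smaller `W` would
    -- bound the slopes of `y` at a time `a m + s`, contradicting the infimum.
    by_contra! hne
    have hlt : ∀ i, ⟪v, ζ i s⟫ < sInf S * ⟪u, ζ i s⟫ := fun i =>
      (hupper i s hs).lt_of_ne fun h => hne i (by rw [hinner, h, sub_self])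
    have h1 : ∀ᶠ W in 𝓝[<] (sInf S), ∀ i, ⟪v, ζ i s⟫ < W * ⟪u, ζ i s⟫ := by
      rw [eventually_all]
      intro i
      have : Tendsto (fun W : ℝ => W * ⟪u, ζ i s⟫) (𝓝[<] (sInf S)) (𝓝 (sInf S * ⟪u, ζ i s⟫)) :=
        ((continuous_id.mul continuous_const).tendsto _).mono_left nhdsWithin_le_nhds
      exact this.eventually (lt_mem_nhds (hlt i))
    obtain ⟨W, hW, hWlt⟩ := (h1.and self_mem_nhdsWithin).exists
    have h2 : ∀ᶠ m in atTop, ∀ i, ⟪v, y i (a m + s)⟫ < W * ⟪u, y i (a m + s)⟫ := by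
      rw [eventually_all]
      intro i
      exact (hlimi v i s hs).eventually_lt ((hlimi u i s hs).const_mul W) (hW i)
    obtain ⟨m, hm, hm0⟩ := (h2.and (hev 0 s)).exists
    exact (not_le.2 hWlt) (csInf_le hSbd ⟨a m + s, hm0, fun i => (hm i).le⟩)

/-- On a ray, the amplitudes converge to `ρ`. -/
theorem IsArraySolution.exists_near_of_ray (hkc : IsArrayCoeff k c ρ) {y : ι → ℝ → V}
    (hy : IsArraySolution k c y) (hM : ∀ i t, 0 ≤ t → ‖y i t‖ ≤ M) {e : V} {p : ℝ} (hp : 0 < p)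
    (hray : ∀ i t, 0 ≤ t → ‖y i t‖ = ⟪e, y i t⟫) (h0 : ∀ i, p ≤ ⟪e, y i 0⟫) {ε : ℝ} (hε : 0 < ε) :
    ∃ t, 0 ≤ t ∧ ∀ i, |⟪e, y i t⟫ - ρ| ≤ ε := by
  have hρ := hkc.pos
  have hcont : Continuous fun s => k s * s := hkc.continuous.mul continuous_id
  -- The cap `ρ / 2` keeps `ρ - ε'` positive.
  set ε' := min ε (ρ / 2)
  have hε' : 0 < ε' := by positivity
  have hε'ρ : ε' < ρ := (min_le_right _ _).trans_lt (by linarith)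
  have hupper : ∃ T, 0 ≤ T ∧ ∀ t, T ≤ t → ∀ i, ⟪e, y i t⟫ ≤ ρ + ε' := by
    set h := max M (ρ + ε')
    -- The minimum of `k(s) s` over a compact interval beyond `ρ` is a definite rate of decrease for
    -- the largest amplitude.
    obtain ⟨s₀, hs₀, hmin⟩ := (isCompact_Icc (a := ρ + ε') (b := h)).exists_isMinOn
      ⟨_, le_rfl, le_max_right _ _⟩ hcont.continuousOn
    refine eventually_le_of_decreasing (c := k s₀ * s₀) (h := h)
      (mul_pos (hkc.damping_pos _ (by linarith [hs₀.1])) (by linarith [hs₀.1])) (le_max_right _ _)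
      (fun i t ht => hy.hasDerivWithinAt_inner e i ht)
      (fun i => by rw [← hray i 0 le_rfl]; exact (hM i 0 le_rfl).trans (le_max_left _ _)) ?_
    intro t ht b hb hle i hi
    have h1 : k s₀ * s₀ ≤ k b * b := hmin hb
    have h2 : ∑ j, c i j ‖y j t - y i t‖ * (⟪e, y j t⟫ - ⟪e, y i t⟫) ≤ 0 :=
      Finset.sum_nonpos fun j _ => mul_nonpos_of_nonneg_of_nonpos
        (hkc.coupling_nonneg i j _ (norm_nonneg _)) (by rw [hi]; linarith [hle j])
    rw [hray i t ht]
    rw [hi] at h2 ⊢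
    linarith
  have hlower : ∃ T, 0 ≤ T ∧ ∀ t, T ≤ t → ∀ i, -⟪e, y i t⟫ ≤ -(ρ - ε') := by
    set h := min p (ρ - ε')
    have hh : 0 < h := lt_min hp (by linarith)
    obtain ⟨s₀, hs₀, hmax⟩ := (isCompact_Icc (a := h) (b := ρ - ε')).exists_isMaxOn
      ⟨_, min_le_right _ _, le_rfl⟩ hcont.continuousOn
    refine eventually_le_of_decreasing (c := -(k s₀ * s₀)) (h := -h)
      (neg_pos.2 (mul_neg_of_neg_of_pos (hkc.damping_neg _ (by linarith [hs₀.1])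
        (by linarith [hs₀.2])) (by linarith [hs₀.1]))) (neg_le_neg (min_le_right _ _))
      (fun i t ht => (hy.hasDerivWithinAt_inner e i ht).neg)
      (fun i => neg_le_neg ((min_le_left _ _).trans (h0 i))) ?_
    intro t ht b hb hle i hi
    have hi' : ⟪e, y i t⟫ = -b := by linarith
    have h1 : k (-b) * (-b) ≤ k s₀ * s₀ := hmax ⟨by linarith [hb.2], by linarith [hb.1]⟩
    have h2 : 0 ≤ ∑ j, c i j ‖y j t - y i t‖ * (⟪e, y j t⟫ - ⟪e, y i t⟫) :=
      Finset.sum_nonneg fun j _ => mul_nonneg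
        (hkc.coupling_nonneg i j _ (norm_nonneg _)) (by
          have := hle j
          rw [hi']; linarith)
    rw [hray i t ht]
    rw [hi'] at h2 ⊢
    linarith
  obtain ⟨T₁, hT₁, h1⟩ := hupper
  obtain ⟨T₂, -, h2⟩ := hlower
  refine ⟨max T₁ T₂, hT₁.trans (le_max_left _ _), fun i => ?_⟩
  have h3 := h1 _ (le_max_left T₁ T₂) i
  have h4 := h2 _ (le_max_right T₁ T₂) i
  have h5 : ε' ≤ ε := min_le_left _ _
  rw [abs_le]
  constructor <;> linarith

end Array

/-! ### Cones in the plane: stability and synchronization -/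

section PlanarArray

open Set Filter Topology
open scoped RealInnerProductSpace

/-- Rotation by a right angle. -/
def Plane.perp (u : Plane) : Plane := !₂[-u 1, u 0]

theorem Plane.inner_eq (u x : Plane) : ⟪u, x⟫ = u 0 * x 0 + u 1 * x 1 := by
  simp [PiLp.inner_apply, Fin.sum_univ_two, mul_comm]

theorem Plane.eq_add_perp {u : Plane} (hu : ‖u‖ = 1) (x : Plane) :
    x = ⟪u, x⟫ • u + ⟪Plane.perp u, x⟫ • Plane.perp u := by
  have h : u 0 * u 0 + u 1 * u 1 = 1 := by
    rw [← Plane.inner_eq, real_inner_self_eq_norm_sq, hu, one_pow]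
  ext q
  fin_cases q
  · simp [Plane.inner_eq, Plane.perp]
    linear_combination (-x 0) * h
  · simp [Plane.inner_eq, Plane.perp]
    linear_combination (-x 1) * h

theorem Plane.norm_perp (u : Plane) : ‖Plane.perp u‖ = ‖u‖ := by
  rw [EuclideanSpace.norm_eq, EuclideanSpace.norm_eq]
  simp [Fin.sum_univ_two, Plane.perp, add_comm]

theorem Plane.norm_le_add {u : Plane} (hu : ‖u‖ = 1) (x : Plane) :
    ‖x‖ ≤ |⟪u, x⟫| + |⟪Plane.perp u, x⟫| := by
  conv_lhs => rw [Plane.eq_add_perp hu x]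
  refine (norm_add_le _ _).trans ?_
  simp [norm_smul, Plane.norm_perp, hu]

variable {ι : Type*} [Fintype ι] {k : ℝ → ℝ} {c : ι → ι → ℝ → ℝ} {ρ M : ℝ} {y : ι → ℝ → Plane}

namespace IsArraySolution

/-- The cone is an intersection of two half-planes through the origin, each of them invariant. -/
theorem abs_inner_perp_le (hkc : IsArrayCoeff k c ρ) (hy : IsArraySolution k c y)
    (hM : ∀ i t, 0 ≤ t → ‖y i t‖ ≤ M) {u : Plane} {W : ℝ}
    (h0 : ∀ i, |⟪Plane.perp u, y i 0⟫| ≤ W * ⟪u, y i 0⟫) {t : ℝ} (ht : 0 ≤ t) (i : ι) :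
    |⟪Plane.perp u, y i t⟫| ≤ W * ⟪u, y i t⟫ := by
  have h1 := hy.inner_nonpos hkc hM (n := Plane.perp u - W • u) (fun i => by
    have := (abs_le.1 (h0 i)).2
    rw [inner_sub_left, real_inner_smul_left]; linarith) ht i
  have h2 := hy.inner_nonpos hkc hM (n := -Plane.perp u - W • u) (fun i => by
    have := (abs_le.1 (h0 i)).1
    rw [inner_sub_left, real_inner_smul_left, inner_neg_left]; linarith) ht i
  rw [inner_sub_left, real_inner_smul_left] at h1 h2
  rw [inner_neg_left] at h2
  rw [abs_le]
  constructor <;> linarith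

theorem norm_le_mul_inner (hkc : IsArrayCoeff k c ρ) (hy : IsArraySolution k c y)
    (hM : ∀ i t, 0 ≤ t → ‖y i t‖ ≤ M) {u : Plane} (hu : ‖u‖ = 1) {W : ℝ}
    (hpos : ∀ i, 0 ≤ ⟪u, y i 0⟫)
    (h0 : ∀ i, |⟪Plane.perp u, y i 0⟫| ≤ W * ⟪u, y i 0⟫) {t : ℝ} (ht : 0 ≤ t) (i : ι) :
    ‖y i t‖ ≤ (1 + W) * ⟪u, y i t⟫ := by
  have h1 := hy.abs_inner_perp_le hkc hM h0 ht i
  have h2 := hy.inner_nonpos hkc hM (n := -u) (fun i => by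
    rw [inner_neg_left]; linarith [hpos i]) ht i
  rw [inner_neg_left] at h2
  have h3 := Plane.norm_le_add hu (y i t)
  rw [abs_of_nonneg (by linarith : 0 ≤ ⟪u, y i t⟫)] at h3
  linarith

/-- Components near `e` start in a thin cone about `e`. Invariance of the cone prevents the
direction from drifting, and bounds close to `ρ` from both sides confine the amplitude. -/
theorem stable (hkc : IsArrayCoeff k c ρ) {δ : ℝ} (hδ : 0 < δ) :
    ∃ h, 0 < h ∧ ∀ y : ι → ℝ → Plane, IsArraySolution k c y → ∀ e : Plane, ‖e‖ = ρ →
      (∀ i, ‖y i 0 - e‖ ≤ h) → ∀ t, 0 ≤ t → ∀ i, ‖y i t - e‖ ≤ δ := by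
  have hρ := hkc.pos
  -- The error is at most `3h` along `e` and `W (ρ + h) ≤ 3h` across it, hence `6h`; `h ≤ ρ / 2`
  -- gives `W ≤ 1` and `W ρ ≤ 2h`.
  set h := min (ρ / 2) (δ / 6) with hh
  have h0 : 0 < h := by positivity
  have hhρ : h ≤ ρ / 2 := min_le_left _ _
  have hhδ : h ≤ δ / 6 := min_le_right _ _
  refine ⟨h, h0, fun y hy e he hy0 t ht i => ?_⟩
  set u : Plane := ρ⁻¹ • e with hu
  have hu1 : ‖u‖ = 1 := by
    rw [hu, norm_smul, he, Real.norm_of_nonneg (by positivity), inv_mul_cancel₀ hρ.ne']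
  have heu : e = ρ • u := by rw [hu, smul_smul, mul_inv_cancel₀ hρ.ne', one_smul]
  have huu : ⟪u, u⟫ = 1 := by rw [real_inner_self_eq_norm_sq, hu1, one_pow]
  have hpu : ⟪Plane.perp u, u⟫ = 0 := by
    rw [Plane.inner_eq]; simp [Plane.perp]; ring
  have hM : ∀ i t, 0 ≤ t → ‖y i t‖ ≤ ρ + h := fun i t ht =>
    hy.norm_le hkc (by linarith) (fun i => by
      have := norm_le_norm_add_norm_sub e (y i 0)
      rw [norm_sub_rev] at this
      linarith [hy0 i]) ht i
  have hu_sub : ∀ i t, ⟪u, y i t - e⟫ = ⟪u, y i t⟫ - ρ := by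
    intro i t; rw [inner_sub_right, heu, real_inner_smul_right, huu, mul_one]
  have hp_sub : ∀ i t, ⟪Plane.perp u, y i t - e⟫ = ⟪Plane.perp u, y i t⟫ := by
    intro i t; rw [inner_sub_right, heu, real_inner_smul_right, hpu, mul_zero, sub_zero]
  have ha0 : ∀ i, ρ - h ≤ ⟪u, y i 0⟫ := by
    intro i
    have h1 := abs_real_inner_le_norm u (y i 0 - e)
    rw [hu1, one_mul, hu_sub] at h1
    linarith [(abs_le.1 (h1.trans (hy0 i))).1]
  have hb0 : ∀ i, |⟪Plane.perp u, y i 0⟫| ≤ h := by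
    intro i
    have h1 := abs_real_inner_le_norm (Plane.perp u) (y i 0 - e)
    rw [Plane.norm_perp, hu1, one_mul, hp_sub] at h1
    exact h1.trans (hy0 i)
  have hρh : 0 < ρ - h := by linarith
  set W := h / (ρ - h) with hW
  have hW0 : 0 ≤ W := by positivity
  have hWh : W * (ρ - h) = h := by rw [hW]; field_simp
  have hcone0 : ∀ i, |⟪Plane.perp u, y i 0⟫| ≤ W * ⟪u, y i 0⟫ := by
    intro i
    have : W * (ρ - h) ≤ W * ⟪u, y i 0⟫ := by gcongr; exact ha0 i
    linarith [hb0 i]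
  have hpos0 : ∀ i, 0 ≤ ⟪u, y i 0⟫ := fun i => hρh.le.trans (ha0 i)
  have hcone := fun i t (ht : 0 ≤ t) => hy.norm_le_mul_inner hkc hM hu1 hpos0 hcone0 ht i
  set p := (ρ - h) / (1 + W) with hp
  have hp0 : 0 < p := by positivity
  have hWp : (1 + W) * p = ρ - h := by rw [hp]; field_simp
  have ha := hy.le_inner hkc hcone hp0 (by linarith) (fun i => by
    have : p ≤ (1 + W) * p := by nlinarith
    linarith [ha0 i]) ht i
  have hb := hy.abs_inner_perp_le hkc hM hcone0 ht i
  have ha' : ⟪u, y i t⟫ ≤ ρ + h := by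
    have := real_inner_le_norm u (y i t)
    rw [hu1, one_mul] at this
    exact this.trans (hM i t ht)
  have hW2 : W * ρ ≤ 2 * h := by nlinarith
  have hW1 : W ≤ 1 := by rw [hW, div_le_one hρh]; linarith
  have hpρ : ρ - 3 * h ≤ p := by
    have : W * p ≤ W * ρ := by
      gcongr
      nlinarith
    linarith
  have hfin := Plane.norm_le_add hu1 (y i t - e)
  rw [hu_sub, hp_sub] at hfin
  have h1 : |⟪u, y i t⟫ - ρ| ≤ 3 * h := by
    rw [abs_le]; constructor <;> linarith
  have h2 : W * ⟪u, y i t⟫ ≤ W * (ρ + h) := by gcongr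
  have h3 : W * h ≤ h := by nlinarith
  linarith

/-- A limit solution of a solution that starts in an open half-plane approaches the synchronous
oscillations. -/
theorem exists_near_sync [Nonempty ι] (hkc : IsArrayCoeff k c ρ) (hy : IsArraySolution k c y)
    {ζ : ι → ℝ → Plane} (hζ : IsArraySolution k c ζ) {u : Plane} (hu : ‖u‖ = 1)
    (hu0 : ∀ i, 0 < ⟪u, y i 0⟫) {a : ℕ → ℝ} (ha : Tendsto a atTop atTop)
    (hlim : ∀ i s, 0 ≤ s → Tendsto (fun n => y i (a n + s)) atTop (𝓝 (ζ i s)))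
    {edge : ι → ι → Prop} (hedge : ∀ i j, edge i j → ∀ s, 0 < s → 0 < c i j s) {r : ι}
    (hr : ∀ i, Relation.ReflTransGen edge i r) {ε : ℝ} (hε : 0 < ε) :
    ∃ t, 0 ≤ t ∧ ∃ e : Plane, ‖e‖ = ρ ∧ ∀ i, ‖ζ i t - e‖ ≤ ε := by
  have hρ := hkc.pos
  obtain ⟨M', hM'⟩ := Finite.exists_le fun i => ‖y i 0‖
  have hM : ∀ i t, 0 ≤ t → ‖y i t‖ ≤ max M' (ρ + 1) := fun i t ht =>
    hy.norm_le hkc (lt_max_of_lt_right (by linarith)) (fun i => (hM' i).trans (le_max_left _ _)) ht i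
  obtain ⟨W', hW'⟩ := Finite.exists_le fun i => |⟪Plane.perp u, y i 0⟫| / ⟪u, y i 0⟫
  have hW0 : 0 ≤ W' := le_trans (div_nonneg (abs_nonneg _) (hu0 r).le) (hW' r)
  have hcone0 : ∀ i, |⟪Plane.perp u, y i 0⟫| ≤ W' * ⟪u, y i 0⟫ := fun i =>
    (div_le_iff₀ (hu0 i)).1 (hW' i)
  have hcone := fun i t (ht : 0 ≤ t) =>
    hy.norm_le_mul_inner hkc hM hu (fun i => (hu0 i).le) hcone0 ht i
  obtain ⟨j, hj⟩ := Finite.exists_min fun i => ⟪u, y i 0⟫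
  -- The second entry forces `(1 + W') p ≤ ρ / 2`, as `le_inner` needs an amplitude below `ρ` at
  -- contact.
  set p := min ⟪u, y j 0⟫ (ρ / (2 * (1 + W'))) with hp
  have hp0 : 0 < p := lt_min (hu0 j) (by positivity)
  have hpρ : (1 + W') * p < ρ := by
    have : (1 + W') * p ≤ (1 + W') * (ρ / (2 * (1 + W'))) := by gcongr; exact min_le_right _ _
    have h2 : (1 + W') * (ρ / (2 * (1 + W'))) = ρ / 2 := by field_simp
    linarith
  have hinner : ∀ i t, 0 ≤ t → p ≤ ⟪u, y i t⟫ := fun i t ht =>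
    hy.le_inner hkc hcone hp0 hpρ (fun i => (min_le_left _ _).trans (hj i)) ht i
  obtain ⟨W₁, h1, h1r⟩ := hy.exists_slope_limit hkc hζ hM (v := Plane.perp u) hp0 hinner ha hlim
    hedge hr
  obtain ⟨W₂, h2, h2r⟩ := hy.exists_slope_limit hkc hζ hM (v := -Plane.perp u) hp0 hinner ha hlim
    hedge hr
  have hev : ∀ s : ℝ, 0 ≤ s → ∀ᶠ m in atTop, 0 ≤ a m + s := fun s hs => by
    filter_upwards [ha.eventually_ge_atTop 0] with m hm
    linarith
  have hζu : ∀ i s, 0 ≤ s → p ≤ ⟪u, ζ i s⟫ := fun i s hs =>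
    ge_of_tendsto (tendsto_const_nhds.inner (hlim i s hs))
      ((hev s hs).mono fun m hm => hinner i _ hm)
  have hζM : ∀ i s, 0 ≤ s → ‖ζ i s‖ ≤ max M' (ρ + 1) := fun i s hs =>
    le_of_tendsto (hlim i s hs).norm ((hev s hs).mono fun m hm => hM i _ hm)
  -- The root attains both the largest and the smallest slope, so the two coincide and all
  -- components lie on one ray.
  have hW₂ : W₂ = -W₁ := by
    have e1 := h1r 0 le_rfl
    have e2 := h2r 0 le_rfl
    rw [inner_neg_left, e1] at e2
    have := hζu r 0 le_rfl
    have h3 : (W₂ + W₁) * ⟪u, ζ r 0⟫ = 0 := by linarith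
    rcases mul_eq_zero.1 h3 with h4 | h4 <;> linarith
  have hslope : ∀ i s, 0 ≤ s → ⟪Plane.perp u, ζ i s⟫ = W₁ * ⟪u, ζ i s⟫ := by
    intro i s hs
    have e1 := h1 i s hs
    have e2 := h2 i s hs
    rw [inner_neg_left, hW₂] at e2
    linarith
  set d : Plane := u + W₁ • Plane.perp u with hd
  have hζd : ∀ i s, 0 ≤ s → ζ i s = ⟪u, ζ i s⟫ • d := by
    intro i s hs
    conv_lhs => rw [Plane.eq_add_perp hu (ζ i s), hslope i s hs]
    rw [hd, smul_add, smul_smul, mul_comm]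
  have hdn : 0 < ‖d‖ := by
    rw [norm_pos_iff]
    intro h
    have e1 := hζd r 0 le_rfl
    rw [h, smul_zero] at e1
    have e2 := hζu r 0 le_rfl
    rw [e1, inner_zero_right] at e2
    linarith
  set e : Plane := ‖d‖⁻¹ • d with he
  have hen : ‖e‖ = 1 := by
    rw [he, norm_smul, norm_inv, norm_norm, inv_mul_cancel₀ hdn.ne']
  have hde : d = ‖d‖ • e := by rw [he, smul_smul, mul_inv_cancel₀ hdn.ne', one_smul]
  have hζe : ∀ i s, 0 ≤ s → ζ i s = (⟪u, ζ i s⟫ * ‖d‖) • e := by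
    intro i s hs
    rw [← smul_smul, ← hde]; exact hζd i s hs
  have hζi : ∀ i s, 0 ≤ s → ⟪e, ζ i s⟫ = ⟪u, ζ i s⟫ * ‖d‖ := by
    intro i s hs
    conv_lhs => rw [hζe i s hs]
    rw [real_inner_smul_right, real_inner_self_eq_norm_sq, hen, one_pow, mul_one]
  have hζn : ∀ i s, 0 ≤ s → ‖ζ i s‖ = ⟪e, ζ i s⟫ := by
    intro i s hs
    have := hζu i s hs
    conv_lhs => rw [hζe i s hs]
    rw [norm_smul, hen, mul_one, hζi i s hs, Real.norm_of_nonneg]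
    exact mul_nonneg (by linarith) hdn.le
  obtain ⟨t, ht, hnear⟩ := hζ.exists_near_of_ray hkc hζM (e := e) (p := p * ‖d‖) (by positivity)
    hζn (fun i => by
      rw [hζi i 0 le_rfl]
      gcongr
      exact hζu i 0 le_rfl) hε
  refine ⟨t, ht, ρ • e, by rw [norm_smul, hen, mul_one, Real.norm_of_nonneg hρ.le], fun i => ?_⟩
  have e1 := hζe i t ht
  rw [← hζi i t ht] at e1
  rw [e1, ← sub_smul, norm_smul, hen, mul_one]
  have := hnear i
  rwa [Real.norm_eq_abs]

end IsArraySolution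

end PlanarArray

/-! ### Geometry of the state space and of the synchronization set -/

section ArrayStateGeometry

open Set Filter Topology Metric
open scoped RealInnerProductSpace

variable {m : ℕ}

theorem osc_apply (x : ArrayState m) (i : Fin m) (q : Fin 2) : osc x i q = x (i, q) := by
  fin_cases q <;> simp [osc]

theorem osc_sub (x y : ArrayState m) (i : Fin m) : osc (x - y) i = osc x i - osc y i := by
  ext q; simp [osc_apply]

/-- The projection onto the `i`-th oscillator as a continuous linear map. -/
noncomputable def oscCLM (i : Fin m) : ArrayState m →L[ℝ] Plane :=
  LinearMap.toContinuousLinearMap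
    { toFun := fun x => osc x i
      map_add' := fun x y => by ext q; simp [osc_apply]
      map_smul' := fun a x => by ext q; simp [osc_apply] }

@[simp]
theorem oscCLM_apply (i : Fin m) (x : ArrayState m) : oscCLM i x = osc x i := rfl

theorem continuous_osc (i : Fin m) : Continuous fun x : ArrayState m => osc x i :=
  (oscCLM i).continuous

theorem norm_sq_eq_sum_osc (x : ArrayState m) : ‖x‖ ^ 2 = ∑ i, ‖osc x i‖ ^ 2 := by
  rw [EuclideanSpace.norm_sq_eq, Fintype.sum_prod_type]
  refine Finset.sum_congr rfl fun i _ => ?_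
  rw [EuclideanSpace.norm_sq_eq]
  simp [osc_apply]

theorem norm_osc_le (x : ArrayState m) (i : Fin m) : ‖osc x i‖ ≤ ‖x‖ := by
  rw [← sq_le_sq₀ (norm_nonneg _) (norm_nonneg _), norm_sq_eq_sum_osc]
  exact Finset.single_le_sum (f := fun i => ‖osc x i‖ ^ 2) (fun _ _ => by positivity)
    (Finset.mem_univ i)

theorem norm_le_of_norm_osc_le {x : ArrayState m} {h : ℝ} (hh : 0 ≤ h)
    (hx : ∀ i, ‖osc x i‖ ≤ h) : ‖x‖ ≤ m * h := by
  rw [← sq_le_sq₀ (norm_nonneg _) (by positivity), norm_sq_eq_sum_osc]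
  calc ∑ i, ‖osc x i‖ ^ 2 ≤ ∑ _i : Fin m, h ^ 2 := by gcongr with i; exact hx i
    _ = m * h ^ 2 := by simp
    _ ≤ (m : ℝ) ^ 2 * h ^ 2 := by
      gcongr
      exact_mod_cast Nat.le_self_pow two_ne_zero m
    _ = (m * h) ^ 2 := by ring

/-- The state in which every oscillator is at `e`. -/
def syncState (m : ℕ) (e : Plane) : ArrayState m := WithLp.toLp 2 fun p => e p.2

theorem osc_syncState (e : Plane) (i : Fin m) : osc (syncState m e) i = e := by
  ext q; simp [osc_apply, syncState]

theorem syncState_mem {e : Plane} {ρ : ℝ} (he : ‖e‖ = ρ) : syncState m e ∈ syncSet m ρ :=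
  fun i j => by simp [osc_syncState, he]

theorem syncSet_nonempty {ρ : ℝ} (hρ : 0 ≤ ρ) : (syncSet m ρ).Nonempty :=
  ⟨_, syncState_mem (e := EuclideanSpace.single 0 ρ) (by simp [abs_of_nonneg hρ])⟩

theorem isCompact_syncSet {ρ : ℝ} (hρ : 0 ≤ ρ) : IsCompact (syncSet m ρ) := by
  refine isCompact_of_isClosed_isBounded ?_ ?_
  · have : syncSet m ρ = ⋂ i, ⋂ j, {x | osc x i = osc x j} ∩ {x | ‖osc x i‖ = ρ} := by
      ext x; simp [syncSet]
    rw [this]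
    exact isClosed_iInter fun i => isClosed_iInter fun j =>
      (isClosed_eq (continuous_osc i) (continuous_osc j)).inter
        (isClosed_eq (continuous_osc i).norm continuous_const)
  · refine isBounded_closedBall (x := 0) (r := m * ρ) |>.subset fun x hx => ?_
    rw [mem_closedBall_zero_iff]
    exact norm_le_of_norm_osc_le hρ fun i => (hx i i).2.le

theorem infDist_syncSet_le {x : ArrayState m} {e : Plane} {ρ h : ℝ} (he : ‖e‖ = ρ) (hh : 0 ≤ h)
    (hx : ∀ i, ‖osc x i - e‖ ≤ h) : infDist x (syncSet m ρ) ≤ m * h := by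
  refine (infDist_le_dist_of_mem (syncState_mem he)).trans ?_
  rw [dist_eq_norm]
  refine norm_le_of_norm_osc_le hh fun i => ?_
  rw [osc_sub, osc_syncState]
  exact hx i

theorem exists_near_of_infDist_le [NeZero m] {x : ArrayState m} {ρ h : ℝ} (hρ : 0 ≤ ρ)
    (hx : infDist x (syncSet m ρ) ≤ h) : ∃ e : Plane, ‖e‖ = ρ ∧ ∀ i, ‖osc x i - e‖ ≤ h := by
  obtain ⟨z, hz, hxz⟩ := (isCompact_syncSet hρ).exists_infDist_eq_dist (syncSet_nonempty hρ) x
  refine ⟨osc z 0, (hz 0 0).2, fun i => ?_⟩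
  rw [← (hz i 0).1, ← osc_sub]
  refine (norm_osc_le _ _).trans ?_
  rwa [← dist_eq_norm, ← hxz]

/-- Strict separation of the origin from `D`; it is what places all oscillators in one open
half-plane. -/
theorem exists_unit_inner_pos {D : Set Plane} (hD : IsCompact D) (hconv : Convex ℝ D)
    (h0 : (0 : Plane) ∉ D) (hne : D.Nonempty) :
    ∃ u : Plane, ‖u‖ = 1 ∧ ∀ x ∈ D, 0 < ⟪u, x⟫ := by
  obtain ⟨g, s, h1, h2⟩ := geometric_hahn_banach_point_closed hconv hD.isClosed h0
  rw [map_zero] at h1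
  set v := (InnerProductSpace.toDual ℝ Plane).symm g
  have hv : ∀ x, ⟪v, x⟫ = g x := fun x => InnerProductSpace.toDual_symm_apply
  have hv0 : v ≠ 0 := by
    rintro h
    obtain ⟨x, hx⟩ := hne
    have := h2 x hx
    rw [← hv, h, inner_zero_left] at this
    linarith
  refine ⟨‖v‖⁻¹ • v, by rw [norm_smul, norm_inv, norm_norm,
    inv_mul_cancel₀ (norm_ne_zero_iff.2 hv0)], fun x hx => ?_⟩
  rw [real_inner_smul_left, hv]
  have := h2 x hx
  have : 0 < ‖v‖ := norm_pos_iff.2 hv0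
  exact mul_pos (by positivity) (by linarith)

theorem isCompact_forall_osc_mem {D : Set Plane} (hD : IsCompact D) :
    IsCompact {x : ArrayState m | ∀ i, osc x i ∈ D} := by
  refine isCompact_of_isClosed_isBounded ?_ ?_
  · rw [ofPred_forall]
    exact isClosed_iInter fun i => hD.isClosed.preimage (continuous_osc i)
  · obtain ⟨C, hC⟩ := hD.isBounded.exists_norm_le
    refine isBounded_closedBall (x := 0) (r := m * max C 0) |>.subset fun x hx => ?_
    rw [mem_closedBall_zero_iff]
    exact norm_le_of_norm_osc_le (le_max_right _ _) fun i =>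
      (hC _ (hx i)).trans (le_max_left _ _)

end ArrayStateGeometry

/-! ### Truncation of coordinates -/

section Truncation

open Set Filter Topology Metric

variable {κ : Type*}

theorem EuclideanSpace.norm_le_sum_abs [Fintype κ] (x : EuclideanSpace ℝ κ) : ‖x‖ ≤ ∑ p, |x p| := by
  classical
  have h : x = ∑ p, EuclideanSpace.single p (x p) := by
    ext q
    simp [Finset.sum_apply, Pi.single_apply]
  conv_lhs => rw [h]
  refine (norm_sum_le _ _).trans ?_
  simp

/-- Truncation of all coordinates at `±R`. -/
def truncate (R : ℝ) (x : EuclideanSpace ℝ κ) : EuclideanSpace ℝ κ :=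
  WithLp.toLp 2 fun p => max (-R) (min R (x p))

theorem truncate_lipschitz [Fintype κ] (R : ℝ) : LipschitzWith 1 (truncate (κ := κ) R) := by
  refine LipschitzWith.of_dist_le_mul fun x y => ?_
  rw [NNReal.coe_one, one_mul, EuclideanSpace.dist_eq, EuclideanSpace.dist_eq]
  gcongr with p
  simp only [truncate, Real.dist_eq]
  rw [max_comm (-R), max_comm (-R)]
  refine (abs_max_sub_max_le_abs _ _ _).trans ((abs_min_sub_min_le_max _ _ _ _).trans ?_)
  simp

theorem truncate_eq_self {R : ℝ} {x : EuclideanSpace ℝ κ} (hx : ∀ p, |x p| ≤ R) :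
    truncate R x = x := by
  ext p
  have := abs_le.1 (hx p)
  simp [truncate, this.1, this.2]

theorem norm_truncate_le [Fintype κ] {R : ℝ} (hR : 0 ≤ R) (x : EuclideanSpace ℝ κ) :
    ‖truncate R x‖ ≤ Fintype.card κ * R := by
  refine (EuclideanSpace.norm_le_sum_abs _).trans ?_
  calc ∑ p, |truncate R x p| ≤ ∑ _p : κ, R := by
        gcongr with p
        rw [abs_le]
        exact ⟨le_max_left _ _, max_le (by linarith) (min_le_left _ _)⟩
    _ = _ := by simp

end Truncation

/-! ### Regularity of the rotated field and its average -/

section RotatedField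

open Set Filter Topology Metric Real MeasureTheory

variable {m : ℕ} {f : ℝ → ℝ} {γ : Fin m → Fin m → ℝ → ℝ}

theorem LocallyLipschitz.mul_real {X : Type*} [PseudoEMetricSpace X] {g h : X → ℝ}
    (hg : LocallyLipschitz g) (hh : LocallyLipschitz h) : LocallyLipschitz fun x => g x * h x := by
  have : LocallyLipschitz fun p : ℝ × ℝ => p.1 * p.2 :=
    ContDiff.locallyLipschitz (𝕂 := ℝ) (by fun_prop)
  exact this.comp (hg.prodMk hh)

theorem LocallyLipschitz.finset_sum_real {X J : Type*} [PseudoEMetricSpace X] {g : J → X → ℝ}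
    (s : Finset J) (hg : ∀ j ∈ s, LocallyLipschitz (g j)) :
    LocallyLipschitz fun x => ∑ j ∈ s, g j x := by
  classical
  induction s using Finset.induction_on with
  | empty => simpa using LocallyLipschitz.const (0 : ℝ)
  | insert a s ha ih =>
    simp only [Finset.sum_insert ha]
    exact (hg a (Finset.mem_insert_self _ _)).add
      (ih fun j hj => hg j (Finset.mem_insert_of_mem hj))

theorem rotatedField_apply (x : ArrayState m) (φ : ℝ) (p : Fin m × Fin 2) :
    rotatedField f γ x φ p =
      -(f (rotatedPosition φ (osc x p.1)) * rotatedVelocity φ (osc x p.1) *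
        rotatedDirection φ p.2) +
      ∑ j ∈ Finset.univ.erase p.1,
        γ p.1 j (rotatedVelocity φ (osc x j - osc x p.1)) * rotatedDirection φ p.2 := by
  simp [rotatedField]

theorem rotatedField_lipschitzOn (hf : LocallyLipschitz f)
    (hγ : ∀ i j, i ≠ j → LocallyLipschitz (γ i j)) (R : ℝ) :
    ∃ K : ℝ≥0, ∀ φ, LipschitzOnWith K (fun x => rotatedField f γ x φ) (closedBall 0 R) := by
  have hcomp : ∀ p : Fin m × Fin 2, ∃ K : ℝ≥0, ∀ φ,
      LipschitzOnWith K (fun x => rotatedField f γ x φ p) (closedBall 0 R) := by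
    intro p
    -- Treating `cos φ` and `sin φ` as free variables in `[-1, 1]` confines the phase to a compact
    -- set, so the Lipschitz constant is uniform in `φ`.
    let G : ArrayState m × ℝ × ℝ → ℝ := fun z =>
      -(f (z.2.1 * z.1 (p.1, 0) + z.2.2 * z.1 (p.1, 1)) *
        (-z.2.2 * z.1 (p.1, 0) + z.2.1 * z.1 (p.1, 1)) * (if p.2 = 0 then -z.2.2 else z.2.1)) +
      ∑ j ∈ Finset.univ.erase p.1,
        γ p.1 j (-z.2.2 * (z.1 (j, 0) - z.1 (p.1, 0)) + z.2.1 * (z.1 (j, 1) - z.1 (p.1, 1))) *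
          (if p.2 = 0 then -z.2.2 else z.2.1)
    have hd : LocallyLipschitz fun z : ArrayState m × ℝ × ℝ =>
        if p.2 = 0 then -z.2.2 else z.2.1 := by
      split_ifs
      · exact ContDiff.locallyLipschitz (𝕂 := ℝ) (by fun_prop)
      · exact ContDiff.locallyLipschitz (𝕂 := ℝ) (by fun_prop)
    have hG : LocallyLipschitz G := by
      refine LocallyLipschitz.add ?_ ?_
      · refine LocallyLipschitz.neg (LocallyLipschitz.mul_real (LocallyLipschitz.mul_real ?_ ?_) hd)
        · exact hf.comp (ContDiff.locallyLipschitz (𝕂 := ℝ) (by fun_prop))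
        · exact ContDiff.locallyLipschitz (𝕂 := ℝ) (by fun_prop)
      · refine LocallyLipschitz.finset_sum_real _ fun j hj => LocallyLipschitz.mul_real ?_ hd
        exact (hγ p.1 j (Finset.ne_of_mem_erase hj).symm).comp
          (ContDiff.locallyLipschitz (𝕂 := ℝ) (by fun_prop))
    obtain ⟨K, hK⟩ := hG.locallyLipschitzOn.exists_lipschitzOnWith_of_compact
      ((isCompact_closedBall (0 : ArrayState m) R).prod
        ((isCompact_Icc (a := (-1 : ℝ)) (b := 1)).prod (isCompact_Icc (a := (-1 : ℝ)) (b := 1))))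
    refine ⟨K, fun φ => LipschitzOnWith.of_dist_le_mul fun x hx y hy => ?_⟩
    have hGe : ∀ x, rotatedField f γ x φ p = G (x, cos φ, sin φ) := by
      intro x
      rw [rotatedField_apply]
      have hdir : rotatedDirection φ p.2 = if p.2 = 0 then -sin φ else cos φ := by
        rcases p with ⟨i, q⟩
        fin_cases q <;> simp [rotatedDirection]
      simp [G, hdir, rotatedPosition, rotatedVelocity, osc_apply]
    have hcs : (cos φ, sin φ) ∈ Icc (-1 : ℝ) 1 ×ˢ Icc (-1 : ℝ) 1 :=
      ⟨⟨neg_one_le_cos φ, cos_le_one φ⟩, ⟨neg_one_le_sin φ, sin_le_one φ⟩⟩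
    have := hK.dist_le_mul (x, cos φ, sin φ) ⟨hx, hcs⟩ (y, cos φ, sin φ) ⟨hy, hcs⟩
    rw [hGe, hGe]
    simpa [Prod.dist_eq] using this
  choose K hK using hcomp
  refine ⟨∑ p, K p, fun φ => LipschitzOnWith.of_dist_le_mul fun x hx y hy => ?_⟩
  rw [dist_eq_norm]
  refine (EuclideanSpace.norm_le_sum_abs _).trans ?_
  rw [NNReal.coe_sum, Finset.sum_mul]
  gcongr with p
  exact (hK p φ).dist_le_mul x hx y hy

theorem continuous_rotatedDirection (q : Fin 2) : Continuous fun φ => rotatedDirection φ q := by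
  fin_cases q
  · simp only [rotatedDirection]; simp; fun_prop
  · simp only [rotatedDirection]; simp; fun_prop

theorem rotatedField_continuous (hf : Continuous f) (hγ : ∀ i j, i ≠ j → Continuous (γ i j)) :
    Continuous (Function.uncurry (rotatedField f γ)) := by
  have hd := continuous_rotatedDirection
  have : Continuous fun z : ArrayState m × ℝ => fun p => rotatedField f γ z.1 z.2 p := by
    refine continuous_pi fun p => ?_
    simp only [rotatedField_apply, rotatedPosition, rotatedVelocity, PiLp.sub_apply, osc_apply]
    have hdp : Continuous fun z : ArrayState m × ℝ => rotatedDirection z.2 p.2 :=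
      (hd p.2).comp continuous_snd
    refine Continuous.add ?_ (continuous_finsetSum _ fun j hj => ?_)
    · exact (((hf.comp (by fun_prop)).mul (by fun_prop)).mul hdp).neg
    · exact ((hγ p.1 j (Finset.ne_of_mem_erase hj).symm).comp (by fun_prop)).mul hdp
  exact (PiLp.continuous_toLp 2 _).comp this

theorem rotatedField_continuous_phase (hf : Continuous f)
    (hγ : ∀ i j, i ≠ j → Continuous (γ i j)) (x : ArrayState m) :
    Continuous (rotatedField f γ x) :=
  (rotatedField_continuous hf hγ).uncurry_left x

theorem rotatedField_periodic (x : ArrayState m) :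
    Function.Periodic (rotatedField f γ x) (2 * π) := by
  intro φ
  ext p
  simp [rotatedField_apply, rotatedPosition, rotatedVelocity, rotatedDirection]

/-- Truncated states lie in a fixed compact ball, on which the local Lipschitz and boundedness
properties are uniform. -/
theorem exists_isPeriodicField (hf : LocallyLipschitz f)
    (hγ : ∀ i j, i ≠ j → LocallyLipschitz (γ i j)) {R : ℝ} (hR : 0 ≤ R) :
    ∃ L B : ℝ≥0, IsPeriodicField (fun x φ => rotatedField f γ (truncate R x) φ) L B := by
  set R' := Fintype.card (Fin m × Fin 2) * R
  have hmem : ∀ x : ArrayState m, truncate R x ∈ closedBall (0 : ArrayState m) R' := fun x =>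
    mem_closedBall_zero_iff.2 (norm_truncate_le hR x)
  obtain ⟨L, hL⟩ := rotatedField_lipschitzOn hf hγ R'
  have hc := rotatedField_continuous hf.continuous fun i j h => (hγ i j h).continuous
  obtain ⟨B, hB⟩ := ((isCompact_closedBall (0 : ArrayState m) R').prod
    (isCompact_Icc (a := 0) (b := 2 * π))).exists_bound_of_continuousOn hc.continuousOn
  refine ⟨L, B.toNNReal, ⟨fun φ => ?_, fun x => ?_, fun x φ => ?_, fun x => ?_⟩⟩
  · refine LipschitzWith.of_dist_le_mul fun x y => ?_
    refine ((hL φ).dist_le_mul _ (hmem x) _ (hmem y)).trans ?_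
    gcongr
    simpa using (truncate_lipschitz R).dist_le_mul x y
  · exact rotatedField_continuous_phase hf.continuous (fun i j h => (hγ i j h).continuous) _
  · obtain ⟨ψ, hψ, he⟩ := (rotatedField_periodic (f := f) (γ := γ)
      (truncate R x)).exists_mem_Ico₀ (by positivity) φ
    rw [he]
    exact (hB (truncate R x, ψ) ⟨hmem x, Ico_subset_Icc_self hψ⟩).trans (le_coe_toNNReal _)
  · exact rotatedField_periodic _

/-- The coupling coefficients of the averaged array. -/
noncomputable def arrayCoupling (γ : Fin m → Fin m → ℝ → ℝ) (i j : Fin m) (s : ℝ) : ℝ :=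
  if i = j then 0 else coupAvg (γ i j) s

theorem osc_avgField (hf : Continuous f) (hγ : ∀ i j, i ≠ j → Continuous (γ i j)) {R : ℝ}
    (x : ArrayState m) (i : Fin m) :
    osc (avgField (fun x φ => rotatedField f γ (truncate R x) φ) x) i =
      arrayVelocity (dampAvg f) (arrayCoupling γ) (fun j => osc (truncate R x) j) i := by
  set z := truncate R x
  ext q
  have hcz := rotatedField_continuous_phase hf hγ z
  have h1 : (∫ φ in (0 : ℝ)..(2 * π), rotatedField f γ z φ) (i, q) =
      ∫ φ in (0 : ℝ)..(2 * π), rotatedField f γ z φ (i, q) :=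
    ((EuclideanSpace.proj (𝕜 := ℝ) (i, q)).intervalIntegral_comp_comm
      (hcz.intervalIntegrable (μ := volume) 0 (2 * π))).symm
  have hd := continuous_rotatedDirection
  have hpos : ∀ v : Plane, Continuous fun φ => rotatedPosition φ v := fun v => by
    unfold rotatedPosition; fun_prop
  have hvel : ∀ v : Plane, Continuous fun φ => rotatedVelocity φ v := fun v => by
    unfold rotatedVelocity; fun_prop
  have hi1 : Continuous fun φ => f (rotatedPosition φ (osc z i)) * rotatedVelocity φ (osc z i) *
      rotatedDirection φ q := ((hf.comp (hpos _)).mul (hvel _)).mul (hd q)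
  have hi2 : ∀ j ∈ Finset.univ.erase i, Continuous fun φ =>
      γ i j (rotatedVelocity φ (osc z j - osc z i)) * rotatedDirection φ q := fun j hj =>
    ((hγ i j (Finset.ne_of_mem_erase hj).symm).comp (hvel _)).mul (hd q)
  rw [osc_apply, avgField, PiLp.smul_apply, h1]
  simp only [rotatedField_apply]
  rw [intervalIntegral.integral_add (hi1.fun_neg.intervalIntegrable _ _)
    ((continuous_finsetSum _ hi2).intervalIntegrable _ _), intervalIntegral.integral_neg,
    integral_damping f hf, intervalIntegral.integral_finsetSum
      fun j hj => (hi2 j hj).intervalIntegrable _ _]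
  have h2 : ∑ j ∈ Finset.univ.erase i, ∫ φ in (0 : ℝ)..(2 * π),
      γ i j (rotatedVelocity φ (osc z j - osc z i)) * rotatedDirection φ q =
      ∑ j, 2 * π * (arrayCoupling γ i j ‖osc z j - osc z i‖ * (osc z j - osc z i) q) := by
    rw [← Finset.add_sum_erase _ _ (Finset.mem_univ i)]
    simp only [sub_self, PiLp.zero_apply, mul_zero, zero_add]
    refine Finset.sum_congr rfl fun j hj => ?_
    have hij := (Finset.ne_of_mem_erase hj).symm
    rw [integral_coupling _ (hγ i j hij), arrayCoupling, if_neg hij]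
    ring
  rw [h2, ← Finset.mul_sum]
  have hπ : (2 * π) ≠ 0 := by positivity
  simp only [arrayVelocity, PiLp.add_apply, PiLp.smul_apply, WithLp.ofLp_sum, Finset.sum_apply,
    smul_eq_mul, PiLp.sub_apply]
  field_simp

theorem isArrayCoeff (hf : Continuous f) {ρ : ℝ} (hρ : 0 < ρ)
    (hneg : ∀ s, 0 < s → s < ρ → dampAvg f s < 0) (hpos : ∀ s, ρ < s → 0 < dampAvg f s)
    (hγ : ∀ i j, i ≠ j → LocallyLipschitz (γ i j)) (hI : IsInterconnection γ) :
    IsArrayCoeff (dampAvg f) (arrayCoupling γ) ρ where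
  pos := hρ
  continuous := continuous_dampAvg hf
  damping_neg := hneg
  damping_pos := hpos
  coupling_nonneg i j s hs := by
    unfold arrayCoupling
    split_ifs with h
    · exact le_rfl
    · exact coupAvg_nonneg (hI.sector i j h) hs
  coupling_bound i j R := by
    unfold arrayCoupling
    split_ifs with h
    · exact ⟨0, fun _ _ _ => le_rfl⟩
    · obtain ⟨K, hK⟩ := (hγ i j h).locallyLipschitzOn.exists_lipschitzOnWith_of_compact
        (isCompact_Icc (a := -R) (b := R))
      refine ⟨K, fun s hs hsR => (le_abs_self _).trans (abs_coupAvg_le K.2 (fun r hr => ?_) hs hsR)⟩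
      have := hK.dist_le_mul r (abs_le.1 hr) 0 (abs_le.1 (by simpa using hs.trans hsR))
      simpa [hI.map_zero i j h, Real.dist_eq] using this

/-- The class-`K` lower bound excludes zeros of `γ i j` away from the origin, so the averaged
coupling on an edge is positive at every distance. -/
theorem arrayCoupling_pos (hγ : ∀ i j, i ≠ j → LocallyLipschitz (γ i j)) (hI : IsInterconnection γ)
    {i j : Fin m} (hij : InterconnectionEdge γ i j) {s : ℝ} (hs : 0 < s) :
    0 < arrayCoupling γ i j s := by
  obtain ⟨hne, hne'⟩ := hij
  rw [arrayCoupling, if_neg hne]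
  refine coupAvg_pos (hγ i j hne).continuous (hI.sector i j hne) (fun r hr h0 => ?_) hs
  rcases hI.zero_or_lower_bound i j hne with h | ⟨α, hα, hle⟩
  · exact hne' h
  · have h1 := hle r
    rw [h0, abs_zero] at h1
    have h2 : α 0 < α (Real.nnabs r) := hα.strictMono (by simpa [pos_iff_ne_zero] using hr)
    rw [hα.map_zero] at h2
    exact absurd h1 (not_le.2 (by exact_mod_cast h2))

end RotatedField

/-! ### Stability and attraction for the truncated averaged equation -/

section AveragedSolutions

open Set Filter Topology Metric Real
open scoped RealInnerProductSpace

variable {m : ℕ} {f : ℝ → ℝ} {γ : Fin m → Fin m → ℝ → ℝ} {ρ M R : ℝ}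

theorem abs_apply_le_norm_osc (x : ArrayState m) (p : Fin m × Fin 2) : |x p| ≤ ‖osc x p.1‖ := by
  have := PiLp.norm_apply_le (osc x p.1) p.2
  rwa [osc_apply, Real.norm_eq_abs] at this

theorem truncate_eq_of_norm_osc_le {x : ArrayState m} (hx : ∀ i, ‖osc x i‖ ≤ R) :
    truncate R x = x :=
  truncate_eq_self fun p => (abs_apply_le_norm_osc x p).trans (hx p.1)

/-- Solutions of the truncated averaged equation stay in the region where the truncation is
inactive. -/
theorem averaged_solution (hf : Continuous f) (hγ : ∀ i j, i ≠ j → Continuous (γ i j))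
    (hkc : IsArrayCoeff (dampAvg f) (arrayCoupling γ) ρ) (hρM : ρ < M) (hMR : M ≤ R)
    {η : ℝ → ArrayState m}
    (hη : IsForwardSolution
      (fun _ => avgField fun x φ => rotatedField f γ (truncate R x) φ) η)
    (h0 : ∀ i, ‖osc (η 0) i‖ ≤ M) :
    (∀ i t, 0 ≤ t → ‖osc (η t) i‖ ≤ M) ∧
      IsArraySolution (dampAvg f) (arrayCoupling γ) fun i t => osc (η t) i := by
  have hd : ∀ (i : Fin m) t, 0 ≤ t → HasDerivWithinAt (fun t => osc (η t) i)
      (arrayVelocity (dampAvg f) (arrayCoupling γ) (fun j => osc (truncate R (η t)) j) i)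
      (Ici 0) t := by
    intro i t ht
    have h1 := (oscCLM i).hasFDerivAt.comp_hasDerivWithinAt t (hη t ht)
    rw [oscCLM_apply, osc_avgField hf hγ] at h1
    exact h1
  have hM : ∀ i t, 0 ≤ t → ‖osc (η t) i‖ ≤ M := fun i t ht =>
    hkc.norm_le (y := fun i t => osc (η t) i) hρM hd
      (fun t _ hle i => by rw [truncate_eq_of_norm_osc_le fun i => (hle i).trans hMR]) h0 ht i
  refine ⟨hM, fun i t ht => ?_⟩
  have := hd i t ht
  rwa [truncate_eq_of_norm_osc_le fun i => (hM i t ht).trans hMR] at this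

/-- A limit solution comes close to the synchronization set at some time `t`, and the solution
itself approximates it at the times `a n + t`. -/
theorem averaged_attractive [NeZero m] (hf : Continuous f)
    (hγ : ∀ i j, i ≠ j → LocallyLipschitz (γ i j)) (hI : IsInterconnection γ)
    (hconn : ConnectedInterconnection γ)
    (hkc : IsArrayCoeff (dampAvg f) (arrayCoupling γ) ρ) (hρM : ρ < M) (hMR : M ≤ R) {L B : ℝ≥0}
    (hΦ : IsPeriodicField (fun (x : ArrayState m) φ => rotatedField f γ (truncate R x) φ) L B)
    {η : ℝ → ArrayState m}
    (hη : IsForwardSolution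
      (fun _ => avgField fun x φ => rotatedField f γ (truncate R x) φ) η)
    (h0 : ∀ i, ‖osc (η 0) i‖ ≤ M) {u : Plane} (hu : ‖u‖ = 1) (hu0 : ∀ i, 0 < ⟪u, osc (η 0) i⟫)
    {ε : ℝ} (hε : 0 < ε) : ∃ t, 0 ≤ t ∧ infDist (η t) (syncSet m ρ) < ε := by
  have hγc := fun i j h => (hγ i j h).continuous
  have hM0 : 0 ≤ M := hkc.pos.le.trans hρM.le
  obtain ⟨hηM, hηa⟩ := averaged_solution hf hγc hkc hρM hMR hη h0
  obtain ⟨a, ζ, ha0, ha, hζ, hlim⟩ := hη.exists_limit hΦ.avgField_lipschitz hΦ.avgField_bound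
    (R := m * M) fun t ht => norm_le_of_norm_osc_le hM0 fun i => hηM i t ht
  have hlimo : ∀ i s, 0 ≤ s → Tendsto (fun n => osc (η (a n + s)) i) atTop (𝓝 (osc (ζ s) i)) :=
    fun i s hs => ((continuous_osc i).tendsto _).comp (hlim s hs)
  obtain ⟨-, hζa⟩ := averaged_solution hf hγc hkc hρM hMR hζ fun i =>
    le_of_tendsto (hlimo i 0 le_rfl).norm
      (Eventually.of_forall fun n => hηM i _ (by linarith [ha0 n]))
  obtain ⟨r, hr⟩ := hconn
  have hm : (0 : ℝ) < m := by exact_mod_cast NeZero.pos m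
  obtain ⟨t, ht, e, he, hnear⟩ := hηa.exists_near_sync hkc hζa hu hu0 ha hlimo
    (fun i j hij s hs => arrayCoupling_pos hγ hI hij hs) hr (ε := ε / (2 * m)) (by positivity)
  have h1 : infDist (ζ t) (syncSet m ρ) < ε := by
    have h2 := infDist_syncSet_le he (by positivity) hnear
    have h3 : m * (ε / (2 * m)) = ε / 2 := by field_simp
    linarith
  have h2 : Tendsto (fun n => infDist (η (a n + t)) (syncSet m ρ)) atTop
      (𝓝 (infDist (ζ t) (syncSet m ρ))) :=
    ((continuous_infDist_pt _).tendsto _).comp (hlim t ht)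
  obtain ⟨n, hn⟩ := (h2.eventually (gt_mem_nhds h1)).exists
  exact ⟨a n + t, add_nonneg (ha0 n) ht, hn⟩

theorem averaged_stable [NeZero m] (hf : Continuous f)
    (hγ : ∀ i j, i ≠ j → Continuous (γ i j))
    (hkc : IsArrayCoeff (dampAvg f) (arrayCoupling γ) ρ) (hρM : ρ < M) (hMR : M ≤ R)
    {δ : ℝ} (hδ : 0 < δ) : ∃ δ₁, 0 < δ₁ ∧ ∀ η : ℝ → ArrayState m,
      IsForwardSolution (fun _ => avgField fun x φ => rotatedField f γ (truncate R x) φ) η →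
      infDist (η 0) (syncSet m ρ) ≤ δ₁ → ∀ t, 0 ≤ t → infDist (η t) (syncSet m ρ) ≤ δ := by
  have hm : (0 : ℝ) < m := by exact_mod_cast NeZero.pos m
  obtain ⟨h, hh, hst⟩ := IsArraySolution.stable hkc (δ := δ / m) (by positivity)
  -- The bound `M - ρ` puts the initial oscillators in the ball of radius `M`, where the truncation
  -- is inactive.
  refine ⟨min h (M - ρ), lt_min hh (by linarith), fun η hη h0 t ht => ?_⟩
  obtain ⟨e, he, hnear⟩ := exists_near_of_infDist_le hkc.pos.le h0
  obtain ⟨-, hηa⟩ := averaged_solution hf hγ hkc hρM hMR hη fun i => by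
    have h1 := norm_le_norm_add_norm_sub e (osc (η 0) i)
    rw [norm_sub_rev] at h1
    have h2 := (hnear i).trans (min_le_right _ _)
    linarith
  have h2 := infDist_syncSet_le he (by positivity)
    (hst _ hηa e he (fun i => (hnear i).trans (min_le_left _ _)) t ht)
  rwa [mul_div_cancel₀ _ hm.ne'] at h2

end AveragedSolutions

/-! ### Return from the truncated to the original array -/

section RotatedSolutions

open Set Filter Topology Metric Real
open scoped RealInnerProductSpace

variable {m : ℕ} {f : ℝ → ℝ} {γ : Fin m → Fin m → ℝ → ℝ} {ω R : ℝ}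

theorem IsRotatedSolution.eqOn (hf : LocallyLipschitz f)
    (hγ : ∀ i j, i ≠ j → LocallyLipschitz (γ i j)) {x y : ℝ → ArrayState m}
    (hx : IsRotatedSolution f γ ω x) (hy : IsRotatedSolution f γ ω y) (h0 : x 0 = y 0) :
    EqOn x y (Ici 0) := by
  refine IsForwardSolution.eqOn_of_lipschitzOn (v := fun t x => rotatedField f γ x (ω * t))
    (fun R => ?_) hx hy h0
  obtain ⟨K, hK⟩ := rotatedField_lipschitzOn hf hγ R
  exact ⟨K, fun t => hK _⟩

/-- A statement about the initial value and the trajectory of a solution that keeps the truncation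
inactive transfers from the truncated array to the original one. -/
theorem exists_and_forall_rotatedSolution (hf : LocallyLipschitz f)
    (hγ : ∀ i j, i ≠ j → LocallyLipschitz (γ i j)) {L B : ℝ≥0}
    (hΦ : IsPeriodicField (fun (x : ArrayState m) φ => rotatedField f γ (truncate R x) φ) L B)
    {x₀ : ArrayState m} {P : ℝ → ArrayState m → Prop}
    (hP : ∀ x, IsForwardSolution (fun t y => rotatedField f γ (truncate R y) (ω * t)) x →
      x 0 = x₀ → ∀ t, 0 ≤ t → (∀ i, ‖osc (x t) i‖ ≤ R) ∧ P t (x t)) :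
    (∃ x, IsRotatedSolution f γ ω x ∧ x 0 = x₀) ∧
      ∀ x, IsRotatedSolution f γ ω x → x 0 = x₀ → ∀ t, 0 ≤ t → P t (x t) := by
  obtain ⟨y, hy0, hy⟩ := exists_isForwardSolution
    (v := fun t y => rotatedField f γ (truncate R y) (ω * t)) (L := L) (B := B)
    (fun t => hΦ.lipschitz _)
    (fun y => (hΦ.continuous y).comp (continuous_const.mul continuous_id))
    (fun t y => hΦ.bound _ _) x₀
  have hyP := hP y hy hy0
  have hyr : IsRotatedSolution f γ ω y := by
    intro t ht
    have h1 := hy t ht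
    beta_reduce at h1
    rwa [truncate_eq_of_norm_osc_le (hyP t ht).1] at h1
  refine ⟨⟨y, hyr, hy0⟩, fun x hx hx0 t ht => ?_⟩
  rw [hx.eqOn hf hγ hyr (hx0.trans hy0.symm) ht]
  exact (hyP t ht).2

end RotatedSolutions

/-! ### The theorem -/

theorem mainTheorem3 {m : ℕ} (f : ℝ → ℝ) (γ : Fin m → Fin m → ℝ → ℝ)
    (hf : LocallyLipschitz f) (hL : LienardCondition f)
    (hγ : ∀ i j, i ≠ j → LocallyLipschitz (γ i j))
    (hI : IsInterconnection γ) (hconn : ConnectedInterconnection γ) :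
    ∃ ρ : ℝ, 0 < ρ ∧ kappa f ρ = 0 ∧ (∀ s : ℝ, 0 < s → kappa f s = 0 → s = ρ) ∧
      ∀ (D : Set Plane) (δ : ℝ), IsCompact D → Convex ℝ D → (0 : Plane) ∉ D → 0 < δ →
        ∃ ωstar : ℝ, 0 < ωstar ∧ ∀ ω : ℝ, ωstar ≤ ω →
          (∃ ε : ℝ, 0 < ε ∧ ∀ x₀ : ArrayState m, Metric.infDist x₀ (syncSet m ρ) ≤ ε →
            (∃ x, IsRotatedSolution f γ ω x ∧ x 0 = x₀) ∧
            ∀ x, IsRotatedSolution f γ ω x → x 0 = x₀ →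
              ∀ t : ℝ, 0 ≤ t → Metric.infDist (x t) (syncSet m ρ) ≤ δ) ∧
          (∃ r : ℝ, 0 < r ∧ ∀ x₀ : ArrayState m, (∀ i, osc x₀ i ∈ D) →
            (∃ x, IsRotatedSolution f γ ω x ∧ x 0 = x₀) ∧
            ∀ x, IsRotatedSolution f γ ω x → x 0 = x₀ →
              ∀ t : ℝ, 0 ≤ t → Metric.infDist (x t) (syncSet m ρ) ≤ r) ∧
          (∃ T : ℝ, 0 < T ∧ ∀ x₀ : ArrayState m, (∀ i, osc x₀ i ∈ D) →
            (∃ x, IsRotatedSolution f γ ω x ∧ x 0 = x₀) ∧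
            ∀ x, IsRotatedSolution f γ ω x → x 0 = x₀ →
              ∀ t : ℝ, T ≤ t → Metric.infDist (x t) (syncSet m ρ) ≤ δ) := by
  obtain ⟨ρ, hρ, hκ, huniq, hneg, hpos⟩ := exists_sign_change_dampAvg hf.continuous hL
  refine ⟨ρ, hρ, hκ, huniq, fun D δ hD hconv hD0 hδ => ?_⟩
  have : NeZero m := ⟨by
    obtain ⟨r, -⟩ := hconn
    exact (Fin.pos r).ne'⟩
  have hγc := fun i j h => (hγ i j h).continuous
  have hkc := isArrayCoeff hf.continuous hρ hneg hpos hγ hI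
  obtain ⟨C, hC⟩ := hD.isBounded.exists_norm_le
  set M := max C (2 * ρ)
  have hρM : ρ < M := lt_max_of_lt_right (by linarith)
  -- Room for both regimes: `M + 1` while the solution is within `d ≤ 1` of an averaged one, and `ρ
  -- + 1` once it is within `d` of the synchronization set.
  set R := M + ρ + 1
  have hMR : M ≤ R := by simp only [R]; linarith
  obtain ⟨L, B, hΦ⟩ := exists_isPeriodicField (R := R) hf hγ (by simp only [R]; linarith)
  have hA := isCompact_syncSet (m := m) hρ.le
  have hA' := syncSet_nonempty (m := m) hρ.le
  have hnear : ∀ {x : ArrayState m} {h : ℝ}, Metric.infDist x (syncSet m ρ) ≤ h →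
      ∀ i, ‖osc x i‖ ≤ ρ + h := by
    intro x h hx i
    obtain ⟨e, he, hxe⟩ := exists_near_of_infDist_le hρ.le hx
    have h1 := norm_le_norm_add_norm_sub e (osc x i)
    rw [norm_sub_rev] at h1
    linarith [hxe i]
  have hDM : ∀ {x : ArrayState m}, (∀ i, osc x i ∈ D) → ∀ i, ‖osc x i‖ ≤ M := fun hx i =>
    (hC _ (hx i)).trans (le_max_left _ _)
  set d := min δ 1
  have hd0 : 0 < d := by positivity
  have hdδ : d ≤ δ := min_le_left _ _
  have hd1 : d ≤ 1 := min_le_right _ _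
  obtain ⟨ωs, hωs, hmain⟩ := hΦ.practical_stability hA hA'
    (isCompact_forall_osc_mem (m := m) hD)
    -- Oscillators within `ρ / 2` of a point `e` with `‖e‖ = ρ` satisfy `⟪e, ·⟫ ≥ ρ² / 2`, hence
    -- share an open half-plane.
    (fun δ hδ => averaged_stable hf.continuous hγc hkc hρM hMR hδ) (δ₀ := ρ / 2) (by positivity)
    (fun η hη h0 ε hε => by
      rcases h0 with h0 | h0
      · obtain ⟨u, hu, hu0⟩ := exists_unit_inner_pos hD hconv hD0 ⟨_, h0 0⟩
        exact averaged_attractive hf.continuous hγ hI hconn hkc hρM hMR hΦ hη (hDM h0) hu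
          (fun i => hu0 _ (h0 i)) hε
      · obtain ⟨e, he, hxe⟩ := exists_near_of_infDist_le hρ.le h0
        refine averaged_attractive hf.continuous hγ hI hconn hkc hρM hMR hΦ hη
          (fun i => (hnear h0 i).trans (by
            have : 2 * ρ ≤ M := le_max_right _ _
            linarith)) (u := ρ⁻¹ • e) ?_ (fun i => ?_) hε
        · rw [norm_smul, he, Real.norm_of_nonneg (by positivity), inv_mul_cancel₀ hρ.ne']
        · rw [real_inner_smul_left]
          refine mul_pos (by positivity) ?_
          have h1 : osc (η 0) i = e + (osc (η 0) i - e) := by abel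
          rw [h1, inner_add_right, real_inner_self_eq_norm_sq, he]
          have h2 := (abs_le.1 (abs_real_inner_le_norm e (osc (η 0) i - e))).1
          rw [he] at h2
          have h3 : ρ * ‖osc (η 0) i - e‖ ≤ ρ * (ρ / 2) := by gcongr; exact hxe i
          nlinarith)
    hd0
  refine ⟨ωs, hωs, fun ω hω => ?_⟩
  obtain ⟨ε, hε, T, hT, hsol⟩ := hmain ω hω
  have hDbound : ∀ x, IsForwardSolution (fun t y => rotatedField f γ (truncate R y) (ω * t)) x →
      (∀ i, osc (x 0) i ∈ D) → ∀ t, 0 ≤ t → ∀ i, ‖osc (x t) i‖ ≤ R := by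
    intro x hx hx0 t ht i
    obtain ⟨h1, h2⟩ := (hsol x hx).2 hx0
    rcases le_total T t with h | h
    · have := hnear (h1 t h) i
      simp only [R]
      linarith
    · obtain ⟨η, hη, hη0, hdist⟩ := h2 t ⟨ht, h⟩
      have h3 := (averaged_solution hf.continuous hγc hkc hρM hMR hη
        (by rw [hη0]; exact hDM hx0)).1 i t ht
      have h4 := norm_osc_le (x t - η t) i
      rw [← dist_eq_norm, osc_sub] at h4
      have h5 := norm_le_norm_add_norm_sub (osc (η t) i) (osc (x t) i)
      rw [norm_sub_rev] at h5
      simp only [R]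
      linarith
  -- The radius `m (R + ρ)` comes from comparing a state whose oscillators are bounded by `R` with
  -- one fixed synchronous state.
  refine ⟨⟨ε, hε, fun x₀ hx₀ => ?_⟩, ⟨m * (R + ρ), ?_, fun x₀ hx₀ => ?_⟩, ⟨T, hT, fun x₀ hx₀ => ?_⟩⟩
  · refine exists_and_forall_rotatedSolution hf hγ hΦ
      (P := fun _ y => Metric.infDist y (syncSet m ρ) ≤ δ) fun x hx h0 t ht => ?_
    have h1 := (hsol x hx).1 (by rwa [h0]) t ht
    refine ⟨fun i => (hnear h1 i).trans ?_, h1.trans hdδ⟩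
    simp only [R]; linarith
  · have hm : (0 : ℝ) < m := by exact_mod_cast NeZero.pos m
    have hR : 0 < R := by simp only [R]; linarith
    positivity
  · refine exists_and_forall_rotatedSolution hf hγ hΦ
      (P := fun _ y => Metric.infDist y (syncSet m ρ) ≤ m * (R + ρ)) fun x hx h0 t ht => ?_
    have h1 := hDbound x hx (by rwa [h0]) t ht
    have hR : 0 < R := by simp only [R]; linarith
    refine ⟨h1, infDist_syncSet_le (e := EuclideanSpace.single 0 ρ) (by simp [abs_of_pos hρ])
      (by positivity) fun i => (norm_sub_le _ _).trans (add_le_add (h1 i) ?_)⟩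
    simp [abs_of_pos hρ]
  · have := exists_and_forall_rotatedSolution hf hγ hΦ (ω := ω) (x₀ := x₀)
      (P := fun t y => T ≤ t → Metric.infDist y (syncSet m ρ) ≤ δ) fun x hx h0 t ht => by
        refine ⟨hDbound x hx (by rwa [h0]) t ht, fun h => ?_⟩
        exact (((hsol x hx).2 (by rwa [h0])).1 t h).trans hdδ
    exact ⟨this.1, fun x hx h0 t ht => this.2 x hx h0 t (hT.le.trans ht) ht⟩
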